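/- \textbf{Setting.} Let $n\ge 2$ and $j\ge 1$ with $j\not\equiv 0 \pmod n$. Let $e_{ab}$ be the matrix units, $b=\sum_{i=1}^{n-1}e_{i+1,i}$, $J=e_{1n}\lambda+b$, $V_n=\bigoplus_{i=1}^{n-1}\mathbb R e_{in}$, $e_1=(1,0,\dots,0)^t$. For a smooth curve $\gamma:\mathbb R\to\mathbb R^n$ with $\det(\gamma,\gamma_x,\dots,\gamma_x^{(n-1)})=1$, the central affine moving frame is $g=(\gamma,\gamma_x,\dots,\gamma_x^{(n-1)})$, and the central affine curvature is $u=\sum_{i=1}^{n-1}u_ie_{in}$, where $u_i$ is the determinant of $g$ with its $i$-th column replaced by $\gamma_x^{(n)}$ (so $g_x=g(b+u)$). \textbf{The flow.} For smooth $u:\mathbb R\to V_n$ let $Y(u,\lambda)=\sum_{i\le 1}Y_i\lambda^i$, with smooth $sl(n,\mathbb R)$-valued coefficients, be the unique formal series with $[\partial_x+J+u,Y]=0$, $Y^n=\lambda I_n$ and $Y_1=e_{1n}$. Let $Y_{j,0}(u)$ be the coefficient of $\lambda^0$ in $Y(u,\lambda)^j$, let $\zeta_j(u)$ be the unique strictly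 upper triangular matrix function with $[\partial_x+b+u,\,Y_{j,0}(u)-\zeta_j(u)]\in V_n$, and put $Z_{j,0}(u)=Y_{j,0}(u)-\zeta_j(u)$. A solution of the $j$-th central affine curve flow is a smooth $\gamma:\mathbb R^2\to\mathbb R^n$ such that, for every $t$, $\det(\gamma,\gamma_x,\dots,\gamma_x^{(n-1)})=1$ and $$\gamma_t=g\,Z_{j,0}(u)\,e_1,$$ where $g(\cdot,t)$ and $u(\cdot,t)$ are the moving frame and curvature of $\gamma(\cdot,t)$. \textbf{The matrix $f_{u,h}$ and the system $(\mathrm{BT})_{u,k}$.} For $u:\mathbb R\to V_n$ and $h:\mathbb R\to\mathbb R$ smooth, put $$f_{u,h}(x,\lambda)=J+hI_n+N(u,h),$$ where $N$ is strictly upper triangular with $N_{il}=\binom{l-1}{i-1}h_x^{(l-i)}$ for $i<l<n$ and $N_{in}=\tilde u_i+\binom{n-1}{i-1}h_x^{(n-i)}$ for $i<n$. Here $\tilde u_1,\dots,\tilde u_{n-1}$ are the unique functions, differential polynomials in $u,h$, for which all entries other than the $(1,n)$ entry of the equation $f_x=f(J+u)-(J+\tilde u)f$ hold, where $f=f_{u,h}$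 and $\tilde u=\sum_i\tilde u_ie_{in}$ (rows $n,n-1,\dots,2$ of the last column determine $\tilde u_{n-1},\dots,\tilde u_1$ successively). Define $\xi_n(u,h)$ by $$\det f_{u,h}=(-1)^{n-1}\bigl(\lambda+h_x^{(n-1)}-\xi_n(u,h)\bigr),$$ and let $\eta_{n,j}(u,h)$ be the $(1,1)$ entry of $f_{u,h}(x,0)\,Z_{j,0}(u)-Z_{j,0}(\tilde u)\,f_{u,h}(x,0)$. For $u$ depending on $(x,t)$, a solution of $(\mathrm{BT})_{u,k}$ is a smooth $h:\mathbb R^2\to\mathbb R$ with $$h_x^{(n-1)}=\xi_n(u,h)-k,\qquad h_t=\eta_{n,j}(u,h).$$ \textbf{Theorem.} Let $\gamma(x,t)$ be a solution of the $j$-th central affine curve flow, with $g(\cdot,t)$ and $u(\cdot,t)$ the central affine moving frame and curvature of $\gamma(\cdot,t)$. Let $k$ be a non-zero real constant, let $d(k)\in GL(n,\mathbb R)$ be a constant matrix with $\det d(k)=(-1)^nk$, let $h$ be a solution of $(\mathrm{BT})_{u,k}$, and put $$\tilde g(x,t)=d(k)\,g(x,t)\,f_{u,h}(x,t,0)^{-1}.$$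 Then $h*\gamma(x,t)=\tilde g(x,t)e_1$ is again a solution of the $j$-th central affine curve flow, and $\tilde g(\cdot,t)$ is the central affine moving frame along $h*\gamma(\cdot,t)$. -/

import Mathlib

open scoped ContDiff

noncomputable section

namespace CentralAffine

/-! Matrices are indexed by `Fin n`, so that the classical `(i, j)` entry sits at `(i - 1, j - 1)`.
A `V_n`-valued map `u = ∑ u_i e_{in}` of `x` is recorded by its components `u i : ℝ → ℝ`,
numbered `1 ≤ i ≤ n - 1` as usual; components with other numbers are never used. -/

/-- The first standard basis vector. -/
def e₁ (n : ℕ) : Fin n → ℝ := fun a => if (a : ℕ) = 0 then 1 else 0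

/-- The matrix unit `e_{1n}`. -/
def e1n (n : ℕ) : Matrix (Fin n) (Fin n) ℝ :=
  Matrix.of fun a c => if (a : ℕ) = 0 ∧ (c : ℕ) + 1 = n then 1 else 0

/-- `b = ∑_{i=1}^{n-1} e_{i+1,i}`. -/
def shift (n : ℕ) : Matrix (Fin n) (Fin n) ℝ :=
  Matrix.of fun a c => if (a : ℕ) = (c : ℕ) + 1 then 1 else 0

/-- The matrix `∑_{i=1}^{n-1} u_i(x) e_{in}`. -/
def potential (n : ℕ) (u : ℕ → ℝ → ℝ) (x : ℝ) : Matrix (Fin n) (Fin n) ℝ :=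
  Matrix.of fun a c => if (c : ℕ) + 1 = n ∧ (a : ℕ) + 1 < n then u ((a : ℕ) + 1) x else 0

/-- Membership in `V_n = ⊕_{i=1}^{n-1} ℝ e_{in}`. -/
def InVn (n : ℕ) (M : Matrix (Fin n) (Fin n) ℝ) : Prop :=
  ∀ a c : Fin n, ¬ ((c : ℕ) + 1 = n ∧ (a : ℕ) + 1 < n) → M a c = 0

/-- Entrywise derivative of a matrix-valued function of one real variable. -/
def matDeriv {n : ℕ} (A : ℝ → Matrix (Fin n) (Fin n) ℝ) (x : ℝ) : Matrix (Fin n) (Fin n) ℝ :=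
  Matrix.of fun a c => deriv (fun y => A y a c) x

/-- Entrywise smoothness of a matrix-valued function of one real variable. -/
def MatSmooth {n : ℕ} (A : ℝ → Matrix (Fin n) (Fin n) ℝ) : Prop :=
  ∀ a c : Fin n, ContDiff ℝ ∞ (fun x => A x a c)

/-! ### Curves -/

/-- The matrix `(c, c_x, …, c_x^{(n-1)})`, which is the central affine moving frame if its
determinant is `1`. -/
def frame {n : ℕ} (c : ℝ → Fin n → ℝ) (x : ℝ) : Matrix (Fin n) (Fin n) ℝ :=
  Matrix.of fun a k => iteratedDeriv (k : ℕ) (fun y => c y a) x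

/-- The `i`-th central affine curvature: the determinant of the moving frame with its `i`-th column
`c_x^{(i-1)}` replaced by `c_x^{(n)}`. -/
def curvature {n : ℕ} (c : ℝ → Fin n → ℝ) (i : ℕ) (x : ℝ) : ℝ :=
  Matrix.det (Matrix.of fun a k : Fin n =>
    iteratedDeriv (if (k : ℕ) + 1 = i then n else (k : ℕ)) (fun y => c y a) x)

/-! ### The matrices `Z_{j,0}(u)`

A formal series `∑_{i ≤ i₀} ξ_i(x) λ^i` is a Hahn series in `λ⁻¹`: `ξ_i` is its coefficient at
`-i`, and `HahnSeries.single (-1) 1` is `λ`. -/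

/-- Formal series in `λ`, with finitely many positive powers, whose coefficients are matrix-valued
functions of `x`. -/
abbrev Loop (n : ℕ) : Type := HahnSeries ℤ (ℝ → Matrix (Fin n) (Fin n) ℝ)

/-- `J + u = e_{1n} λ + b + u`. -/
def laxLoop (n : ℕ) (u : ℕ → ℝ → ℝ) : Loop n :=
  HahnSeries.single (-1) (fun _ => e1n n) + HahnSeries.single 0 (fun x => shift n + potential n u x)

/-- `Y` solves `[∂_x + J + u, Y] = 0` and `Y ^ n = λ I`. Since these equations do not distinguish
`Y` from `-Y` if `n` is even, the solution is normalized by `Y = e_{1n} λ + O(1)`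
(so that `Y(0) = J`). -/
structure IsY (n : ℕ) (u : ℕ → ℝ → ℝ) (Y : Loop n) : Prop where
  smooth : ∀ i : ℤ, MatSmooth (Y.coeff i)
  trace_eq_zero : ∀ (i : ℤ) (x : ℝ), (Y.coeff i x).trace = 0
  commutes : ∀ (i : ℤ) (x : ℝ),
    matDeriv (Y.coeff i) x + (laxLoop n u * Y - Y * laxLoop n u).coeff i x = 0
  pow_eq : Y ^ n = HahnSeries.single (-1) 1
  lead : Y.coeff (-1) = fun _ => e1n n
  bounded : ∀ i : ℤ, i < -1 → Y.coeff i = 0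

open Classical in
/-- The series `Y(u, λ)`. -/
def Y (n : ℕ) (u : ℕ → ℝ → ℝ) : Loop n :=
  if hY : ∃ Y, IsY n u Y then hY.choose else 0

/-- `Y_{j,0}(u)`, the coefficient of `λ ^ 0` in `Y(u, λ) ^ j`. -/
def Yj0 (n j : ℕ) (u : ℕ → ℝ → ℝ) : ℝ → Matrix (Fin n) (Fin n) ℝ := (Y n u ^ j).coeff 0

/-- `[∂_x + b + u, C]`. -/
def bracket (n : ℕ) (u : ℕ → ℝ → ℝ) (C : ℝ → Matrix (Fin n) (Fin n) ℝ) (x : ℝ) :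
    Matrix (Fin n) (Fin n) ℝ :=
  matDeriv C x + (shift n + potential n u x) * C x - C x * (shift n + potential n u x)

/-- `ζ` is strictly upper triangular and `[∂_x + b + u, Y_{j,0}(u) - ζ]` takes values in `V_n`. -/
structure IsZeta (n j : ℕ) (u : ℕ → ℝ → ℝ) (ζ : ℝ → Matrix (Fin n) (Fin n) ℝ) : Prop where
  smooth : MatSmooth ζ
  upper : ∀ (x : ℝ) (a c : Fin n), c ≤ a → ζ x a c = 0
  mem : ∀ x : ℝ, InVn n (bracket n u (fun y => Yj0 n j u y - ζ y) x)

open Classical in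
/-- The strictly upper triangular `ζ_j(u)`. -/
def zeta (n j : ℕ) (u : ℕ → ℝ → ℝ) : ℝ → Matrix (Fin n) (Fin n) ℝ :=
  if hζ : ∃ ζ, IsZeta n j u ζ then hζ.choose else 0

/-- `Z_{j,0}(u) = Y_{j,0}(u) - ζ_j(u)`. -/
def Zj0 (n j : ℕ) (u : ℕ → ℝ → ℝ) (x : ℝ) : Matrix (Fin n) (Fin n) ℝ :=
  Yj0 n j u x - zeta n j u x

/-- `γ = γ(x, t)` is a smooth solution on `ℝ²` of the `j`-th central affine curve flow
`γ_t = g Z_{j,0}(u) e_1` on `M_n(ℝ)`. -/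
structure IsCurveFlowSolution (n j : ℕ) (γ : ℝ → ℝ → Fin n → ℝ) : Prop where
  smooth : ContDiff ℝ ∞ (fun p : ℝ × ℝ => γ p.1 p.2)
  det_eq_one : ∀ x t : ℝ, (frame (fun y => γ y t) x).det = 1
  flow : ∀ x t : ℝ, HasDerivAt (fun s => γ x s)
    ((frame (fun y => γ y t) x * Zj0 n j (curvature fun y => γ y t) x).mulVec (e₁ n)) t

/-! ### Bäcklund transformations

The matrix `f = f_{u,h}` relates the Lax operators of `u` and of `ũ = u + s(u,h)` by
`f_x = f (J + u) - (J + ũ) f`, and its first column is `(h, 1, 0, …, 0)`. The first `n - 1` columns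
of this equation give the entries of `f` in terms of `h` and `ũ`; rows `n, n - 1, …, 2` of its last
column then give `ũ_{n-1}, ũ_{n-2}, …, ũ_1` one after the other. -/

/-- `newPotentialAux n u h q` is `ũ_{n-q}`, where `ũ_n = 0`. With `p = n - q`, row `p` of the last
column of `f_x = f (J + u) - (J + ũ) f` reads
`(f_{pn})_x = ∑_{m=p-1}^{n-1} f_{pm} u_m - f_{p-1,n} - ũ_p h` (at `λ = 0`), where
`f_{p,p-1} = 1`, `f_{pm} = C(m-1, p-1) h_x^{(m-p)}` for `p ≤ m < n`, and
`f_{in} = ũ_i + C(n-1, i-1) h_x^{(n-i)}`. It is solved for `ũ_{p-1}`. -/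
def newPotentialAux (n : ℕ) (u : ℕ → ℝ → ℝ) (h : ℝ → ℝ) : ℕ → ℝ → ℝ
  | 0 => fun _ => 0
  | q + 1 => fun x =>
      u (n - q - 1) x
        + ∑ m ∈ Finset.Icc (n - q) (n - 1),
            ((m - 1).choose (n - q - 1) : ℝ) * iteratedDeriv (m - (n - q)) h x * u m x
        - h x * newPotentialAux n u h q x
        - deriv (fun y => newPotentialAux n u h q y
            + ((n - 1).choose (n - q - 1) : ℝ) * iteratedDeriv q h y) x
        - ((n - 1).choose (n - q - 2) : ℝ) * iteratedDeriv (q + 1) h x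

/-- The components `ũ_i = u_i + s_i(u,h)`, `1 ≤ i ≤ n - 1`, of the transformed potential. -/
def newPotential (n : ℕ) (u : ℕ → ℝ → ℝ) (h : ℝ → ℝ) (i : ℕ) : ℝ → ℝ :=
  newPotentialAux n u h (n - i)

/-- The strictly upper triangular matrix `N(u,h)`, with entries `C(j-1, i-1) h_x^{(j-i)}` for
`i < j < n` and `u_i + s_i(u,h) + C(n-1, i-1) h_x^{(n-i)}` for `i < j = n`. -/
def Nmat (n : ℕ) (u : ℕ → ℝ → ℝ) (h : ℝ → ℝ) (x : ℝ) : Matrix (Fin n) (Fin n) ℝ :=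
  Matrix.of fun a c =>
    if (a : ℕ) < (c : ℕ) then
      (if (c : ℕ) + 1 = n then newPotential n u h ((a : ℕ) + 1) x else 0)
        + ((c : ℕ).choose (a : ℕ) : ℝ) * iteratedDeriv ((c : ℕ) - (a : ℕ)) h x
    else 0

/-- `f_{u,h}(x, λ) = J + h I_n + N(u,h)`, where `J = e_{1n} λ + b`. -/
def darboux (n : ℕ) (u : ℕ → ℝ → ℝ) (h : ℝ → ℝ) (x l : ℝ) : Matrix (Fin n) (Fin n) ℝ :=
  l • e1n n + shift n + h x • (1 : Matrix (Fin n) (Fin n) ℝ) + Nmat n u h x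

/-- The differential polynomial `ξ_n(u,h)`, determined by
`det f_{u,h} = (-1)^{n-1} (λ + h_x^{(n-1)} - ξ_n(u,h))`; see `det_darboux`. -/
def xi (n : ℕ) (u : ℕ → ℝ → ℝ) (h : ℝ → ℝ) (x : ℝ) : ℝ :=
  iteratedDeriv (n - 1) h x - (-1) ^ (n - 1) * (darboux n u h x 0).det

theorem det_darboux {n : ℕ} (hn : 1 ≤ n) (u : ℕ → ℝ → ℝ) (h : ℝ → ℝ) (x l : ℝ) :
    (darboux n u h x l).det
      = (-1) ^ (n - 1) * (l + iteratedDeriv (n - 1) h x - xi n u h x) := by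
  obtain ⟨m, rfl⟩ : ∃ m, n = m + 1 := ⟨n - 1, by omega⟩
  have h1 : darboux (m + 1) u h x l = (darboux (m + 1) u h x 0).updateRow 0
      (darboux (m + 1) u h x 0 0 + l • Pi.single (Fin.last m) 1) := by
    ext a c
    by_cases ha : a = 0
    · subst ha
      by_cases hc : c = Fin.last m
      · subst hc
        simp [darboux, e1n]
        ring
      · have hc' : ¬ (c : ℕ) = m := fun hcm => hc (Fin.ext hcm)
        simp [darboux, e1n, hc, hc']
    · have ha' : ¬ (a : ℕ) = 0 := fun h0 => ha (Fin.ext h0)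
      simp [darboux, e1n, ha]
  have h2 : (((darboux (m + 1) u h x 0).submatrix (Fin.succAbove 0)
      (Fin.succAbove (Fin.last m))).det : ℝ) = 1 := by
    rw [Matrix.det_of_isUpperTriangular]
    · apply Finset.prod_eq_one
      intro i _
      have hi : (i.succ : Fin (m + 1)) ≠ i.castSucc := by
        simp [Fin.ext_iff]
      have hlt : ¬ (i : ℕ) + 1 < (i : ℕ) := by omega
      simp only [Matrix.submatrix_apply, Fin.succAbove_zero, Fin.succAbove_last]
      simp [darboux, e1n, shift, Nmat, hi, hlt, -Fin.val_fin_lt]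
    · intro a c hac
      have hac' : (c : ℕ) < (a : ℕ) := hac
      have hi : (a.succ : Fin (m + 1)) ≠ c.castSucc := by
        simp [Fin.ext_iff]
        omega
      have hlt : ¬ (a : ℕ) + 1 < (c : ℕ) := by omega
      have hne : ¬ (a : ℕ) = (c : ℕ) := by omega
      simp only [Matrix.submatrix_apply, Fin.succAbove_zero, Fin.succAbove_last]
      simp [darboux, e1n, shift, Nmat, hi, hlt, hne, -Fin.val_fin_lt]
  have h3 : ((-1 : ℝ) ^ m) * (-1) ^ m = 1 := by
    rw [← mul_pow]
    norm_num
  rw [h1, Matrix.det_updateRow_add, Matrix.updateRow_eq_self, Matrix.det_updateRow_smul,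
    ← Matrix.adjugate_apply, Matrix.adjugate_fin_succ_eq_det_submatrix, h2]
  simp only [xi, Nat.add_sub_cancel, Fin.val_zero, Fin.val_last, zero_add, mul_one]
  linear_combination (-(darboux (m + 1) u h x 0).det) * h3

/-- The differential polynomial `η_{n,j}(u,h)`: the `(1,1)` entry, at `λ = 0`, of
`f Z_j(u,λ) - Z_j(ũ,λ) f`, which is the `t`-derivative of `f = f_{u,h}` when `f` relates frames of
the solutions `u` and `ũ` of the `j`-th flow. -/
def eta (n j : ℕ) (u : ℕ → ℝ → ℝ) (h : ℝ → ℝ) (x : ℝ) : ℝ :=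
  dotProduct (e₁ n) ((darboux n u h x 0 * Zj0 n j u x
    - Zj0 n j (newPotential n u h) x * darboux n u h x 0).mulVec (e₁ n))

/-- `h = h(x, t)` is a smooth solution on `ℝ²` of `(BT)_{u,k}`:
`h_x^{(n-1)} = ξ_n(u,h) - k` and `h_t = η_{n,j}(u,h)`.
Here `u t i` is the `i`-th component of `u(·, t)`. -/
structure IsBTSolution (n j : ℕ) (u : ℝ → ℕ → ℝ → ℝ) (k : ℝ) (h : ℝ → ℝ → ℝ) : Prop where
  smooth : ContDiff ℝ ∞ (fun p : ℝ × ℝ => h p.1 p.2)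
  eq_x : ∀ x t : ℝ,
    iteratedDeriv (n - 1) (fun y => h y t) x = xi n (u t) (fun y => h y t) x - k
  eq_t : ∀ x t : ℝ, HasDerivAt (fun s => h x s) (eta n j (u t) (fun y => h y t) x) t

/-- `g̃(x,t) = d g(x,t) f_{u,h}(x,t,0)⁻¹`, where `g` and `u` are the central affine moving frame and
curvature of `γ`. -/
def btFrame {n : ℕ} (d : Matrix (Fin n) (Fin n) ℝ) (γ : ℝ → ℝ → Fin n → ℝ) (h : ℝ → ℝ → ℝ)
    (x t : ℝ) : Matrix (Fin n) (Fin n) ℝ :=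
  d * frame (fun y => γ y t) x
    * (darboux n (curvature fun y => γ y t) (fun y => h y t) x 0)⁻¹

/-- `h ∗ γ = g̃ e_1`. -/
def btCurve {n : ℕ} (d : Matrix (Fin n) (Fin n) ℝ) (γ : ℝ → ℝ → Fin n → ℝ) (h : ℝ → ℝ → ℝ)
    (x t : ℝ) : Fin n → ℝ :=
  (btFrame d γ h x t).mulVec (e₁ n)

end CentralAffine

end

open scoped ContDiff

noncomputable section

/-! ### Formal dressing in a complete filtered differential ring. -/

namespace CentralAffine

/-! Let `f = f_{u,h}`, and write `ũ` for the transformed potential. The theorem follows once `f` is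
shown to be a gauge transformation in both variables: `f_x = f (b + u) - (b + ũ) f` and `f_t = f
Z_{j,0}(u) - Z_{j,0}(ũ) f` at `λ = 0`. Since `g_x = g (b + u)` and `g_t = g Z_{j,0}(u)`, the product
`g̃ = d g f⁻¹` then satisfies `g̃_x = g̃ (b + ũ)` and `g̃_t = g̃ Z_{j,0}(ũ)`. The first equation
says that each column of `g̃` before the last has the next one as its derivative, so `g̃` is the
frame of its first column, with curvature `ũ`; the first column of the second is the curve flow. The
determinants match because `det f = (-1)^n k = det d`.

The `x`-equation for `f` holds by construction of `ũ`, except in the `(1,n)` entry. The first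
equation of `(BT)_{u,k}` makes `det f` constant, and Jacobi's formula then forces the missing entry
(`matDeriv_darboux`).

The `t`-equation (`matDeriv_darboux_snd`) combines two facts. First, `f Y(u,λ) = Y(ũ,λ) f`
(`IsY.gauge`), because a root of `J ^ n` commuting with the Lax operator is rigid. Comparing
coefficients of `λ^0` shows that the first column of `f Z_{j,0}(u) - Z_{j,0}(ũ) f` vanishes below
its first entry, and that entry is `h_t` by the second equation of `(BT)_{u,k}`. Second, the
difference of the two sides of the `t`-equation solves a linear system in `x`, obtained from `f_{xt}
= f_{tx}`, whose solutions vanish once their first column does (`eq_zero_of_first_column`); the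
unknown evolution of `ũ` enters only through a `V_n`-valued term.

The existence of `Y` and the rigidity are proved in a filtered ring modelled on the principal
grading, where `J` has degree one and `J ^ n = λ` is central and invertible. Existence is a
Newton-type iteration (`FiltDiffRing.step_spec`), rigidity a descent in the degree
(`FiltDiffRing.eq_zero_of_lax`). -/

/-- `∑_{a < m} P ^ a * X * Q ^ (m - 1 - a)`. -/
def nest {R : Type*} [Ring R] (P X Q : R) : ℕ → R
  | 0 => 0
  | m + 1 => P ^ m * X + nest P X Q m * Q

/-- A complete separated filtered ring with a filtered derivation `δ` and an element `J` of degree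
one whose `n`-th power is central, constant and, together with `n`, invertible. -/
structure FiltDiffRing (n : ℕ) (R : Type*) [Ring R] where
  F : ℤ → AddSubgroup R
  mono : ∀ {D E : ℤ}, D ≤ E → F D ≤ F E
  mul_mem : ∀ {D E : ℤ} {X Y : R}, X ∈ F D → Y ∈ F E → X * Y ∈ F (D + E)
  sep : ∀ X : R, (∀ m : ℕ, X ∈ F (-m)) → X = 0
  complete : ∀ X : ℕ → R, (∀ m : ℕ, X (m + 1) - X m ∈ F (-m)) →
    ∃ Y, ∀ m : ℕ, Y - X m ∈ F (-m)
  J : R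
  J_mem : J ∈ F 1
  J_comm : ∀ X : R, J ^ n * X = X * J ^ n
  w : R
  w_mem : w ∈ F (-n)
  w_comm : ∀ X : R, w * X = X * w
  w_J : n • (w * J ^ n) = 1
  δ : R →+ R
  leibniz : ∀ X Y : R, δ (X * Y) = δ X * Y + X * δ Y
  δ_mem : ∀ {D : ℤ} {X : R}, X ∈ F D → δ X ∈ F D
  δ_J : δ J = 0

theorem nest_telescope {R : Type*} [Ring R] (P Q f : R) (m : ℕ) :
    nest P (f * Q - P * f) Q m = f * Q ^ m - P ^ m * f := by
  induction m with
  | zero => simp [nest]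
  | succ m ih => rw [nest, ih, pow_succ Q, pow_succ P]; noncomm_ring

theorem add_pow_sub_pow {R : Type*} [Ring R] (P X : R) (m : ℕ) :
    (P + X) ^ m - P ^ m = nest P X (P + X) m := by
  have := nest_telescope P (P + X) 1 m
  rw [one_mul, mul_one, add_sub_cancel_left] at this
  rw [this, one_mul, mul_one]

theorem nest_add {R : Type*} [Ring R] (P X X' Q : R) (m : ℕ) :
    nest P (X + X') Q m = nest P X Q m + nest P X' Q m := by
  induction m with
  | zero => simp [nest]
  | succ m ih => simp only [nest, ih]; noncomm_ring

theorem mul_nest_sub_nest_mul {R : Type*} [Ring R] (P X Q : R) (m : ℕ) :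
    P * nest P X Q m - nest P X Q m * Q = P ^ m * X - X * Q ^ m := by
  induction m with
  | zero => simp [nest]
  | succ m ih =>
    have h : P * nest P X Q (m + 1) - nest P X Q (m + 1) * Q
        = P ^ (m + 1) * X - P ^ m * X * Q + (P * nest P X Q m - nest P X Q m * Q) * Q := by
      rw [nest, pow_succ']; noncomm_ring
    rw [h, ih, pow_succ Q]; noncomm_ring

/-- The bracket `[δ + L, Y]` for possibly different operators on the two sides. -/
def FiltDiffRing.lax {n : ℕ} {R : Type*} [Ring R] (G : FiltDiffRing n R) (L' L X : R) : R :=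
  G.δ X + L' * X - X * L

namespace FiltDiffRing

variable {n : ℕ} {R : Type*} [Ring R] (G : FiltDiffRing n R)

theorem mul_mem' {D E K : ℤ} {X Y : R} (hX : X ∈ G.F D) (hY : Y ∈ G.F E) (h : D + E ≤ K) :
    X * Y ∈ G.F K := G.mono h (G.mul_mem hX hY)

theorem pow_mem_of {D : ℤ} {X : R} (h1 : (1 : R) ∈ G.F 0) (hX : X ∈ G.F D) (m : ℕ) :
    X ^ m ∈ G.F (m * D) := by
  induction m with
  | zero => simpa using h1
  | succ m ih => rw [pow_succ]; exact G.mul_mem' ih hX (by push_cast; linarith)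

theorem J_pow_mem' {m : ℕ} (hm : m ≠ 0) : G.J ^ m ∈ G.F m := by
  induction m with
  | zero => exact absurd rfl hm
  | succ m ih =>
    rcases Nat.eq_zero_or_pos m with rfl | h
    · simpa using G.J_mem
    · rw [pow_succ]; exact G.mul_mem' (ih h.ne') G.J_mem (by push_cast; linarith)

theorem one_mem (hn : n ≠ 0) : (1 : R) ∈ G.F 0 := by
  rw [← G.w_J]
  exact nsmul_mem (G.mul_mem' G.w_mem (G.J_pow_mem' hn) (by simp)) n

theorem pow_mem (hn : n ≠ 0) {D : ℤ} {X : R} (hX : X ∈ G.F D) (m : ℕ) : X ^ m ∈ G.F (m * D) :=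
  G.pow_mem_of (G.one_mem hn) hX m

theorem J_pow_mem (hn : n ≠ 0) (m : ℕ) : G.J ^ m ∈ G.F m := by
  simpa using G.pow_mem hn G.J_mem m

theorem eq_w_J_mul (X : R) : X = n • (G.w * (G.J ^ n * X)) := by
  rw [← mul_assoc, ← smul_mul_assoc, G.w_J, one_mul]

theorem J_pow_cancel (hn : n ≠ 0) {m : ℕ} (hm : m ≤ n) {D : ℤ} {X : R}
    (h : G.J ^ m * X ∈ G.F (D + m)) : X ∈ G.F D := by
  rw [G.eq_w_J_mul X]
  obtain ⟨q, rfl⟩ := Nat.exists_eq_add_of_le' hm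
  rw [pow_add, mul_assoc]
  refine nsmul_mem (G.mul_mem' G.w_mem (G.mul_mem (G.J_pow_mem hn q) h) ?_) _
  push_cast; linarith

theorem nsmul_cancel (hn : n ≠ 0) {D : ℤ} {X : R} (h : n • X ∈ G.F D) : X ∈ G.F D := by
  have h2 : X = G.w * G.J ^ n * (n • X) := by
    rw [mul_smul_comm, ← smul_mul_assoc, G.w_J, one_mul]
  rw [h2]
  exact G.mul_mem' (G.mul_mem G.w_mem (G.J_pow_mem hn n)) h (by simp)

theorem mem_F_one {P : R} (hP : P - G.J ∈ G.F 0) : P ∈ G.F 1 := by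
  have := add_mem (G.mono (by norm_num : (0 : ℤ) ≤ 1) hP) G.J_mem
  simpa using this

theorem pow_sub_J_pow (hn : n ≠ 0) {P : R} (hP : P - G.J ∈ G.F 0) (m : ℕ) :
    P ^ m - G.J ^ m ∈ G.F (m - 1) := by
  induction m with
  | zero => simp
  | succ m ih =>
    have h : P ^ (m + 1) - G.J ^ (m + 1) = (P ^ m - G.J ^ m) * P + G.J ^ m * (P - G.J) := by
      rw [pow_succ, pow_succ]; noncomm_ring
    rw [h]
    exact add_mem (G.mul_mem' ih (G.mem_F_one hP) (by push_cast; linarith))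
      (G.mul_mem' (G.J_pow_mem hn m) hP (by push_cast; linarith))

theorem nest_mem (hn : n ≠ 0) {P Q X : R} {d : ℤ} (hP : P ∈ G.F 1) (hQ : Q ∈ G.F 1)
    (hX : X ∈ G.F d) (m : ℕ) : nest P X Q m ∈ G.F (d + m - 1) := by
  induction m with
  | zero => simp [nest]
  | succ m ih =>
    exact add_mem (G.mul_mem' (G.pow_mem hn hP m) hX (by push_cast; linarith))
      (G.mul_mem' ih hQ (by push_cast; linarith))

/-- Since `P` and `Q` agree with `J` up to lower degree, the leading part of the sum can be computed
with `J` on both sides. -/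
theorem nest_congr (hn : n ≠ 0) {P Q X : R} {d : ℤ} (hP : P - G.J ∈ G.F 0)
    (hQ : Q - G.J ∈ G.F 0) (hX : X ∈ G.F d) (m : ℕ) :
    nest P X Q m - nest G.J X G.J m ∈ G.F (d + m - 2) := by
  induction m with
  | zero => simp [nest]
  | succ m ih =>
    have h : nest P X Q (m + 1) - nest G.J X G.J (m + 1) =
        (P ^ m - G.J ^ m) * X + ((nest P X Q m - nest G.J X G.J m) * Q
          + nest G.J X G.J m * (Q - G.J)) := by
      simp only [nest]; noncomm_ring
    rw [h]
    refine add_mem (G.mul_mem' (G.pow_sub_J_pow hn hP m) hX (by push_cast; linarith))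
      (add_mem (G.mul_mem' ih (G.mem_F_one hQ) (by push_cast; linarith))
      (G.mul_mem' (G.nest_mem hn G.J_mem G.J_mem hX m) hQ (by push_cast; linarith)))

/-- If moving `J` past `X` costs only lower-order terms, all the summands of the nest agree to
leading order. -/
theorem nest_comm (hn : n ≠ 0) {X : R} {d : ℤ} (hX : G.J * X - X * G.J ∈ G.F d) (m : ℕ) :
    nest G.J X G.J (m + 1) - (m + 1) • (G.J ^ m * X) ∈ G.F (d + m - 1) := by
  induction m with
  | zero => simp [nest]
  | succ m ih =>
    have h : nest G.J X G.J (m + 1 + 1) - (m + 1 + 1) • (G.J ^ (m + 1) * X) =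
        (nest G.J X G.J (m + 1) - (m + 1) • (G.J ^ m * X)) * G.J
          - (m + 1) • (G.J ^ m * (G.J * X - X * G.J)) := by
      rw [nest, pow_succ]
      simp only [succ_nsmul, mul_assoc, mul_sub, sub_mul, smul_mul_assoc, smul_sub, add_mul]
      abel
    rw [h]
    exact sub_mem (G.mul_mem' ih G.J_mem (by push_cast; linarith))
      (nsmul_mem (G.mul_mem' (G.J_pow_mem hn m) hX (by push_cast; linarith)) _)

/-- To leading order the nest is `n J ^ (n - 1) X`, and `n J ^ (n - 1)` can be cancelled because `n`
and `J ^ n` are invertible. This is the degree drop used in both uniqueness and existence. -/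
theorem mem_pred_of_nest (hn : n ≠ 0) {X : R} {d : ℤ} (hX : G.J * X - X * G.J ∈ G.F d)
    (h0 : nest G.J X G.J n ∈ G.F (d + n - 2)) : X ∈ G.F (d - 1) := by
  obtain ⟨m, rfl⟩ := Nat.exists_eq_succ_of_ne_zero hn
  have h := G.nest_comm hn hX m
  have h1 : (m + 1) • (G.J ^ m * X) ∈ G.F (d + m - 1) := by
    have := sub_mem (G.mono (by push_cast; linarith) h0) h
    simpa using this
  exact G.J_pow_cancel hn (Nat.le_succ m) (G.mono (by linarith) (G.nsmul_cancel hn h1))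

/-- The top-degree part of the Lax equation says that the leading part of `X` commutes with `J`; the
nest condition then kills it. The degree of `X` thus drops indefinitely, and separatedness gives `X
= 0`. -/
theorem eq_zero_of_lax (hn : n ≠ 0) {P Q L L' X : R} {d : ℤ} (hP : P - G.J ∈ G.F 0)
    (hQ : Q - G.J ∈ G.F 0) (hL : L - G.J ∈ G.F 0) (hL' : L' - G.J ∈ G.F 0) (hX : X ∈ G.F d)
    (hlax : G.lax L' L X = 0) (hnest : nest P X Q n = 0) : X = 0 := by
  have step : ∀ {d : ℤ}, X ∈ G.F d → X ∈ G.F (d - 1) := by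
    intro d hX
    refine G.mem_pred_of_nest hn ?_ ?_
    · have h : G.J * X - X * G.J = -(G.δ X + (L' - G.J) * X - X * (L - G.J)) := by
        have h3 : G.J * X - X * G.J
            = G.lax L' L X - (G.δ X + (L' - G.J) * X - X * (L - G.J)) := by
          rw [lax]; noncomm_ring
        rw [h3, hlax, zero_sub]
      rw [h]
      exact neg_mem (sub_mem (add_mem (G.δ_mem hX) (G.mul_mem' hL' hX (by simp)))
        (G.mul_mem' hX hL (by simp)))
    · have := G.nest_congr hn hP hQ hX n
      rw [hnest, zero_sub] at this
      exact neg_mem_iff.1 this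
  have all : ∀ q : ℕ, X ∈ G.F (d - q) := by
    intro q
    induction q with
    | zero => simpa using hX
    | succ q ih => exact G.mono (by push_cast; linarith) (step ih)
  refine G.sep X fun m => G.mono ?_ (all (d + m).toNat)
  have := Int.self_le_toNat (d + m)
  linarith

theorem lax_mul (L'' L' L X Y : R) :
    G.lax L'' L (X * Y) = G.lax L'' L' X * Y + X * G.lax L' L Y := by
  simp only [lax, G.leibniz]; noncomm_ring

theorem lax_sub (L' L X Y : R) : G.lax L' L (X - Y) = G.lax L' L X - G.lax L' L Y := by
  simp only [lax, map_sub]; noncomm_ring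

theorem lax_add (L' L X Y : R) : G.lax L' L (X + Y) = G.lax L' L X + G.lax L' L Y := by
  simp only [lax, map_add]; noncomm_ring

theorem δ_one : G.δ 1 = 0 := by
  have := G.leibniz 1 1
  simpa using this

theorem lax_pow_nest (L X : R) (m : ℕ) : G.lax L L (X ^ m) = nest X (G.lax L L X) X m := by
  induction m with
  | zero => simp [nest, lax, G.δ_one]
  | succ m ih => rw [nest, ← ih, pow_succ, G.lax_mul L L L, add_comm]

theorem lax_pow (L X : R) (h : G.lax L L X = 0) (m : ℕ) : G.lax L L (X ^ m) = 0 := by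
  rw [lax_pow_nest, h]
  induction m with
  | zero => rfl
  | succ m ih => simp [nest, ih]

/-- A gauge transformation between two Lax operators intertwines the `n`-th roots of `J ^ n` which
commute with them. -/
theorem intertwine (hn : n ≠ 0) {P Q L L' f : R} (hP : P - G.J ∈ G.F 0)
    (hQ : Q - G.J ∈ G.F 0) (hL : L - G.J ∈ G.F 0) (hL' : L' - G.J ∈ G.F 0)
    (hf : f ∈ G.F 1) (hPn : P ^ n = G.J ^ n) (hQn : Q ^ n = G.J ^ n)
    (hPL : G.lax L' L' P = 0) (hQL : G.lax L L Q = 0) (hfL : G.lax L' L f = 0) :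
    f * Q = P * f := by
  rw [← sub_eq_zero]
  -- The defect is annihilated by the Lax operator by the Leibniz rule, and its nest telescopes to
  -- `f Q ^ n - P ^ n f`, which is zero because `J ^ n` is central.
  refine G.eq_zero_of_lax hn (X := f * Q - P * f) (d := 2) hP hQ hL hL' ?_ ?_ ?_
  · exact sub_mem (G.mul_mem' hf (G.mem_F_one hQ) (by norm_num))
      (G.mul_mem' (G.mem_F_one hP) hf (by norm_num))
  · rw [lax_sub, G.lax_mul L' L L, G.lax_mul L' L' L, hPL, hQL, hfL]; simp
  · rw [nest_telescope, hPn, hQn, G.J_comm, sub_self]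

end FiltDiffRing

/-- `∑_{a < m} a * J ^ a * X * J ^ (m - 1 - a)`. -/
def weightedNest {R : Type*} [Ring R] (J X : R) : ℕ → R
  | 0 => 0
  | m + 1 => m • (J ^ m * X) + weightedNest J X m * J

/-- Summation by parts: the weights `a` make the weighted nest an approximate inverse of `[J, ·]`,
exact when the plain nest of `X` vanishes. -/
theorem comm_weightedNest {R : Type*} [Ring R] (J X : R) (m : ℕ) :
    J * weightedNest J X m - weightedNest J X m * J = m • (J ^ m * X) - J * nest J X J m := by
  induction m with
  | zero => simp [nest, weightedNest]
  | succ m ih =>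
    have h : J * weightedNest J X (m + 1) - weightedNest J X (m + 1) * J
        = m • (J ^ (m + 1) * X) - m • (J ^ m * X) * J
          + (J * weightedNest J X m - weightedNest J X m * J) * J := by
      rw [weightedNest, pow_succ']
      simp only [mul_add, add_mul, mul_smul_comm, sub_mul, mul_assoc]
      abel
    rw [h, ih, nest, pow_succ']
    simp only [succ_nsmul, mul_add, sub_mul, mul_assoc]
    abel

theorem nest_nsmul {R : Type*} [Ring R] (P X Q : R) (k m : ℕ) :
    nest P (k • X) Q m = k • nest P X Q m := by
  induction m with
  | zero => simp [nest]
  | succ m ih => simp only [nest, ih, smul_add, mul_smul_comm, smul_mul_assoc]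

theorem nest_mul_left {R : Type*} [Ring R] (P X Q K : R) (hK : Commute P K) (m : ℕ) :
    nest P (K * X) Q m = K * nest P X Q m := by
  induction m with
  | zero => simp [nest]
  | succ m ih => rw [nest, nest, ih, ← mul_assoc, (hK.pow_left m).eq]; noncomm_ring

theorem nest_mul_right {R : Type*} [Ring R] (P X Q : R) (m : ℕ) :
    nest P (X * Q) Q m = nest P X Q m * Q := by
  induction m with
  | zero => simp [nest]
  | succ m ih => rw [nest, nest, ih]; noncomm_ring

theorem nest_weightedNest {R : Type*} [Ring R] (J X : R) (k m : ℕ) :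
    nest J (weightedNest J X m) J k = weightedNest J (nest J X J k) m := by
  induction m with
  | zero =>
    rw [weightedNest, weightedNest]
    have := nest_nsmul J 0 J 0 k
    simpa using this
  | succ m ih =>
    rw [weightedNest, weightedNest, nest_add, nest_nsmul,
      nest_mul_left _ _ _ _ ((Commute.refl J).pow_right m), nest_mul_right, ih]

namespace FiltDiffRing

variable {n : ℕ} {R : Type*} [Ring R] (G : FiltDiffRing n R)

theorem weightedNest_mem (hn : n ≠ 0) {X : R} {d : ℤ} (hX : X ∈ G.F d) (m : ℕ) :
    weightedNest G.J X m ∈ G.F (d + m - 1) := by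
  induction m with
  | zero => simp [weightedNest]
  | succ m ih =>
    exact add_mem (nsmul_mem (G.mul_mem' (G.J_pow_mem hn m) hX (by push_cast; linarith)) _)
      (G.mul_mem' ih G.J_mem (by push_cast; linarith))

/-- The next approximation to a root of `J ^ n` commuting with `δ + L`. -/
def step (L Y : R) : R :=
  -(G.w * (G.J * (Y ^ n - G.J ^ n) + weightedNest G.J (G.lax L L Y) n))

theorem δ_J_pow (m : ℕ) : G.δ (G.J ^ m) = 0 := by
  induction m with
  | zero => simpa using G.δ_one
  | succ m ih => rw [pow_succ, G.leibniz, ih, G.δ_J]; simp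

theorem lax_eq (L X : R) :
    G.lax L L X = (G.J * X - X * G.J) + (G.δ X + (L - G.J) * X - X * (L - G.J)) := by
  rw [lax]; noncomm_ring

theorem lax_rest_mem {L X : R} {d : ℤ} (hL : L - G.J ∈ G.F 0) (hX : X ∈ G.F d) :
    G.δ X + (L - G.J) * X - X * (L - G.J) ∈ G.F d :=
  sub_mem (add_mem (G.δ_mem hX) (G.mul_mem' hL hX (by simp))) (G.mul_mem' hX hL (by simp))

/-- To leading order, the correction `Δ` must solve `[J, Δ] = -E` and `nest J Δ J n = -K`, where `E`
and `K` are the two current errors. These equations are compatible because `[J, K]` agrees with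
`nest J E J n` up to lower order, and then `Δ = -w (J K + weightedNest J E n)` solves both. Each
step lowers both errors by one degree. -/
theorem step_spec (hn : n ≠ 0) {L Y : R} {e : ℤ} (hL : L - G.J ∈ G.F 0) (hY : Y - G.J ∈ G.F 0)
    (hE : G.lax L L Y ∈ G.F e) (hG : Y ^ n - G.J ^ n ∈ G.F (e + n - 2)) (he : e ≤ 1) :
    G.step L Y ∈ G.F (e - 1) ∧ G.lax L L (Y + G.step L Y) ∈ G.F (e - 1) ∧
      (Y + G.step L Y) ^ n - G.J ^ n ∈ G.F (e - 1 + n - 2) := by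
  set E := G.lax L L Y with hEdef
  set K := Y ^ n - G.J ^ n with hKdef
  set W := nest G.J E G.J n with hW
  have hJn : G.lax L L (G.J ^ n) = 0 := by
    rw [lax, G.δ_J_pow, G.J_comm L]; simp
  -- Compatibility of the errors: the Lax operator applied to `Y ^ n - J ^ n` is the nest of `E` by
  -- the Leibniz rule.
  have h1 : (G.J * K - K * G.J) - W ∈ G.F (e + n - 2) := by
    have h2 : G.lax L L K = nest Y E Y n := by
      rw [hKdef, lax_sub, hJn, lax_pow_nest, sub_zero]
    rw [lax_eq] at h2
    have h3 := G.nest_congr hn hY hY hE n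
    rw [← h2] at h3
    have h4 := sub_mem h3 (G.lax_rest_mem hL hG)
    convert h4 using 1
    rw [hW]
    abel
  -- `W` commutes with `J` exactly, and its nest is small because that of `[J, K]` telescopes to
  -- zero; hence `W` has one degree less than expected.
  have hWmem : W ∈ G.F (e + n - 2) := by
    have hW1 := G.mem_pred_of_nest hn (X := W) (d := e + n - 1) ?_ ?_
    · exact G.mono (by linarith) hW1
    · rw [hW, mul_nest_sub_nest_mul, G.J_comm, sub_self]; exact zero_mem _
    · have h2 : nest G.J (G.J * K - K * G.J) G.J n = 0 := by
        have h3 := nest_telescope G.J G.J K n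
        rw [G.J_comm, sub_self] at h3
        have h4 := nest_add G.J (K * G.J - G.J * K) (G.J * K - K * G.J) G.J n
        rw [h3, zero_add] at h4
        rw [← h4]
        have h5 := nest_nsmul G.J 0 G.J 0 n
        simpa using h5
      have h3 := nest_add G.J (G.J * K - K * G.J - W) W G.J n
      rw [sub_add_cancel, h2] at h3
      have h4 := G.nest_mem hn G.J_mem G.J_mem h1 n
      rw [← neg_eq_of_add_eq_zero_right h3.symm]
      exact neg_mem (G.mono (by linarith) h4)
  have hKcomm : G.J * K - K * G.J ∈ G.F (e + n - 2) := by
    have := add_mem h1 hWmem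
    simpa using this
  have hΔ : G.step L Y ∈ G.F (e - 1) := by
    refine neg_mem (G.mul_mem' (E := e + n - 1) G.w_mem (add_mem
      (G.mul_mem' G.J_mem hG (by linarith)) (G.weightedNest_mem hn hE n)) (by linarith))
  refine ⟨hΔ, ?_, ?_⟩
  -- The terms `n J ^ n E` of `comm_weightedNest` reproduce `E` after multiplication by `w`; what
  -- remains is the small difference `[J, K] - W`.
  · have hc : G.J * G.step L Y - G.step L Y * G.J + E
        = -(G.w * (G.J * ((G.J * K - K * G.J) - W))) := by
      have h2 := comm_weightedNest G.J E n
      have h3 : E = G.w * (n • (G.J ^ n * E)) := by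
        rw [mul_smul_comm]; exact G.eq_w_J_mul E
      have h4 : G.J * G.step L Y - G.step L Y * G.J = -(G.w * (G.J * (G.J * K - K * G.J)
          + (G.J * weightedNest G.J E n - weightedNest G.J E n * G.J))) := by
        have h5 : G.J * G.step L Y
            = -(G.w * (G.J * (G.J * K + weightedNest G.J E n))) := by
          rw [step, mul_neg, ← mul_assoc, ← G.w_comm, mul_assoc]
        have h6 : G.step L Y = -(G.w * (G.J * K + weightedNest G.J E n)) := rfl
        rw [h5, h6]
        noncomm_ring
      rw [h4, h2]
      nth_rewrite 3 [h3]
      rw [← hW]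
      noncomm_ring
    rw [lax_add, lax_eq G L (G.step L Y)]
    have h5 : G.w * (G.J * ((G.J * K - K * G.J) - W)) ∈ G.F (e - 1) :=
      G.mul_mem' G.w_mem (G.mul_mem G.J_mem h1) (by linarith)
    have h6 := add_mem (neg_mem h5) (G.lax_rest_mem hL hΔ)
    rw [← hc] at h6
    convert h6 using 1
    rw [hEdef]
    abel
  · have h2 : (Y + G.step L Y) ^ n - G.J ^ n = K + nest Y (G.step L Y) (Y + G.step L Y) n := by
      rw [← add_pow_sub_pow]; rw [hKdef]; abel
    have hY' : Y + G.step L Y - G.J ∈ G.F 0 := by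
      have := add_mem hY (G.mono (by linarith) hΔ)
      convert this using 1
      abel
    have h3 := G.nest_congr hn hY hY' hΔ n
    have h4 : nest G.J (G.step L Y) G.J n
        = -(G.w * (G.J * nest G.J K G.J n + weightedNest G.J W n)) := by
      have h5 : G.step L Y = (-G.w) * (G.J * K + weightedNest G.J E n) := by
        rw [step, neg_mul]
      rw [h5, nest_mul_left _ _ _ _ (Commute.neg_right (G.w_comm G.J).symm), nest_add,
        nest_weightedNest, nest_mul_left _ _ _ _ (Commute.refl G.J), neg_mul]
    -- Since `[J, K]` is small, `nest J K J n` is `n J ^ (n - 1) K` to leading order, and `w` turns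
    -- `J` times this into `K`.
    have h5 : K - G.w * (G.J * nest G.J K G.J n) ∈ G.F (e - 1 + n - 2) := by
      obtain ⟨m, rfl⟩ := Nat.exists_eq_succ_of_ne_zero hn
      have h6 := G.nest_comm hn hKcomm m
      have h7 : K = G.w * (G.J * ((m + 1) • (G.J ^ m * K))) := by
        rw [mul_smul_comm, ← mul_assoc, ← pow_succ', mul_smul_comm]
        exact G.eq_w_J_mul K
      have h8 : K - G.w * (G.J * nest G.J K G.J (m + 1))
          = -(G.w * (G.J * (nest G.J K G.J (m + 1) - (m + 1) • (G.J ^ m * K)))) := by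
        nth_rewrite 1 [h7]
        simp only [mul_sub]
        abel
      rw [h8]
      exact neg_mem (G.mul_mem' G.w_mem (G.mul_mem G.J_mem h6) (by push_cast; linarith))
    have h6 : G.w * weightedNest G.J W n ∈ G.F (e - 1 + n - 2) :=
      G.mul_mem' G.w_mem (G.weightedNest_mem hn hWmem n) (by linarith)
    rw [h2]
    have h7 := add_mem h3 (sub_mem h5 h6)
    convert h7 using 1
    rw [h4]
    noncomm_ring

/-- Successive approximations to a root of `J ^ n` commuting with `δ + L`. -/
def approx (L : R) : ℕ → R
  | 0 => G.J
  | m + 1 => approx L m + G.step L (approx L m)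

theorem approx_spec (hn : n ≠ 0) {L : R} (hL : L - G.J ∈ G.F 0) (m : ℕ) :
    G.approx L m - G.J ∈ G.F 0 ∧ G.lax L L (G.approx L m) ∈ G.F (1 - m) ∧
      G.approx L m ^ n - G.J ^ n ∈ G.F (1 - m + n - 2) := by
  induction m with
  | zero =>
    refine ⟨by simp [approx], ?_, by simp [approx]⟩
    have := G.lax_rest_mem hL G.J_mem
    rw [approx, lax_eq, sub_self, zero_add]
    simpa using this
  | succ m ih =>
    obtain ⟨h1, h2, h3⟩ := ih
    obtain ⟨h4, h5, h6⟩ := G.step_spec hn hL h1 h2 h3 (by linarith [Int.natCast_nonneg m])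
    refine ⟨?_, G.mono (by push_cast; linarith) h5, G.mono (by push_cast; linarith) h6⟩
    have := add_mem h1 (G.mono (by linarith [Int.natCast_nonneg m] : (1 - (m : ℤ) - 1) ≤ 0) h4)
    rw [approx]
    convert this using 1
    abel

theorem exists_root (hn : n ≠ 0) {L : R} (hL : L - G.J ∈ G.F 0) :
    ∃ Y, Y - G.J ∈ G.F 0 ∧ G.lax L L Y = 0 ∧ Y ^ n = G.J ^ n := by
  obtain ⟨Y, hY⟩ := G.complete (G.approx L) fun m => by
    obtain ⟨h1, h2, h3⟩ := G.approx_spec hn hL m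
    have := (G.step_spec hn hL h1 h2 h3 (by linarith [Int.natCast_nonneg m])).1
    rw [approx, add_sub_cancel_left]
    exact G.mono (by linarith) this
  have hYJ : Y - G.J ∈ G.F 0 := by simpa [approx] using hY 0
  refine ⟨Y, hYJ, ?_, ?_⟩
  · refine G.sep _ fun m => ?_
    have h1 := (G.approx_spec hn hL (m + 1)).2.1
    have h2 := hY (m + 1)
    have h3 : G.lax L L (Y - G.approx L (m + 1)) ∈ G.F (-m) := by
      rw [lax]
      have hL1 := G.mem_F_one hL
      exact sub_mem (add_mem (G.mono (by push_cast; linarith) (G.δ_mem h2))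
        (G.mul_mem' hL1 h2 (by push_cast; linarith))) (G.mul_mem' h2 hL1 (by push_cast; linarith))
    rw [lax_sub] at h3
    have := add_mem h3 (G.mono (by push_cast; linarith) h1)
    simpa using this
  · rw [← sub_eq_zero]
    refine G.sep _ fun m => ?_
    -- The nest raises the degree by `n - 1`, so the approximation is taken `n` steps further.
    obtain ⟨h0, -, h1⟩ := G.approx_spec hn hL (m + n)
    have h2 := hY (m + n)
    have h3 := add_pow_sub_pow (G.approx L (m + n)) (Y - G.approx L (m + n)) n
    rw [add_sub_cancel] at h3
    have h4 := G.nest_mem hn (G.mem_F_one h0) (G.mem_F_one hYJ) h2 n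
    rw [← h3] at h4
    have := add_mem (G.mono (by push_cast; linarith : _ ≤ -(m : ℤ)) h4)
      (G.mono (by push_cast; linarith) h1)
    simpa using this

/-- A trace takes the same value at `J` and at the other roots of `J ^ n`, up to arbitrarily low
order. -/
theorem exists_trace_eq (hn : n ≠ 0) {A : Type*} [AddCommGroup A] (τ : R →+ A)
    (hτ : ∀ X Y, τ (X * Y) = τ (Y * X)) {Y : R} (hY : Y - G.J ∈ G.F 0) (hYn : Y ^ n = G.J ^ n)
    (m : ℕ) : ∃ Z ∈ G.F (-m), τ Y = τ G.J + τ Z := by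
  -- `S` is `1` plus terms of negative degree and satisfies `J S = S Y`, so it conjugates `Y` to `J`
  -- up to inversion.
  set N := nest G.J 1 Y n with hN
  set S := G.w * (G.J * N) with hS
  have hJS : G.J * S = S * Y := by
    have h1 := mul_nest_sub_nest_mul G.J 1 Y n
    rw [hYn, one_mul, mul_one, sub_self, sub_eq_zero, ← hN] at h1
    calc G.J * S = G.w * (G.J * (G.J * N)) := by rw [hS, ← mul_assoc, ← G.w_comm, mul_assoc]
      _ = G.w * (G.J * N * Y) := by rw [mul_assoc, ← h1]
      _ = S * Y := by rw [hS, mul_assoc, mul_assoc, mul_assoc]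
  have hK : 1 - S ∈ G.F (-1) := by
    have h1 := G.nest_congr hn (d := 0) (P := G.J) (by simp) hY (G.one_mem hn) n
    obtain ⟨q, rfl⟩ := Nat.exists_eq_succ_of_ne_zero hn
    have h2 := G.nest_comm hn (X := 1) (d := 0) (by simp) q
    have h3 : N - (q + 1) • G.J ^ q ∈ G.F (q - 1) := by
      have := add_mem (G.mono (by push_cast; linarith : _ ≤ (q : ℤ) - 1) h1)
        (G.mono (by linarith) h2)
      simpa using this
    have h4 : (1 : R) = G.w * (G.J * ((q + 1) • G.J ^ q)) := by
      rw [mul_smul_comm, ← pow_succ', mul_smul_comm]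
      exact G.w_J.symm
    have h5 : 1 - S = -(G.w * (G.J * (N - (q + 1) • G.J ^ q))) := by
      nth_rewrite 1 [h4]
      rw [hS]
      simp only [mul_sub]
      abel
    rw [h5]
    exact neg_mem (G.mul_mem' G.w_mem (G.mul_mem G.J_mem h3) (by push_cast; linarith))
  set K := 1 - S with hKdef
  have hSK : S = 1 - K := by rw [hKdef]; abel
  -- A truncated Neumann series for the inverse of `S = 1 - K`. The finite sum suffices, since the
  -- error `K ^ (m + 1)` has degree at most `-(m + 1)`.
  set T := ∑ i ∈ Finset.range (m + 1), K ^ i with hT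
  have hST : S * T = 1 - K ^ (m + 1) := by rw [hSK]; exact mul_neg_geom_sum K (m + 1)
  have hTS : T * S = 1 - K ^ (m + 1) := by rw [hSK]; exact geom_sum_mul_neg K (m + 1)
  have hKm : K ^ (m + 1) ∈ G.F (-(m + 1)) :=
    G.mono (by push_cast; linarith) (G.pow_mem hn hK (m + 1))
  refine ⟨K ^ (m + 1) * Y - G.J * K ^ (m + 1), sub_mem
    (G.mul_mem' hKm (G.mem_F_one hY) (by linarith)) (G.mul_mem' G.J_mem hKm (by linarith)), ?_⟩
  have h1 : τ (G.J * (S * T)) = τ (T * S * Y) := by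
    rw [← mul_assoc, hJS, hτ, ← mul_assoc]
  rw [hST, hTS] at h1
  simp only [mul_sub, sub_mul, mul_one, one_mul, map_sub] at h1 ⊢
  rw [sub_eq_iff_eq_add] at h1
  rw [h1]
  abel

end FiltDiffRing

/-! ### Smooth matrix loops and their principal filtration. -/

open HahnSeries

theorem Loop.coeff_mul_apply {n : ℕ} (X Y : Loop n) (i : ℤ) (x : ℝ) (a c : Fin n) :
    (X * Y).coeff i x a c = ∑ p ∈ Finset.antidiagonal X.isPWO_support Y.isPWO_support i,
      ∑ m, X.coeff p.1 x a m * Y.coeff p.2 x m c := by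
  simp [coeff_mul, Finset.sum_apply, Matrix.sum_apply, Matrix.mul_apply]

/-- Loops with smooth coefficients. -/
def smoothLoops (n : ℕ) : Subring (Loop n) where
  carrier := {X | ∀ i, MatSmooth (X.coeff i)}
  mul_mem' := by
    intro X Y hX hY i a c
    simp only [Loop.coeff_mul_apply]
    exact ContDiff.sum fun p _ => ContDiff.sum fun m _ => (hX _ _ _).mul (hY _ _ _)
  one_mem' := by
    intro i a c
    rw [coeff_one]
    split_ifs <;> exact contDiff_const
  add_mem' := by
    intro X Y hX hY i a c
    exact (hX i a c).add (hY i a c)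
  zero_mem' := by
    intro i a c
    exact contDiff_const
  neg_mem' := by
    intro X hX i a c
    exact (hX i a c).neg

theorem MatSmooth.differentiableAt {n : ℕ} {A : ℝ → Matrix (Fin n) (Fin n) ℝ} (hA : MatSmooth A)
    (a c : Fin n) (x : ℝ) : DifferentiableAt ℝ (fun y => A y a c) x :=
  (hA a c).differentiable (by simp) x

theorem MatSmooth.matDeriv {n : ℕ} {A : ℝ → Matrix (Fin n) (Fin n) ℝ} (hA : MatSmooth A) :
    MatSmooth (matDeriv A) := by
  intro a c
  exact (contDiff_infty_iff_deriv.1 (hA a c)).2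

theorem matDeriv_zero {n : ℕ} : matDeriv (0 : ℝ → Matrix (Fin n) (Fin n) ℝ) = 0 := by
  ext x a c
  simp [matDeriv]

theorem matDeriv_const {n : ℕ} (M : Matrix (Fin n) (Fin n) ℝ) :
    matDeriv (fun _ => M) = 0 := by
  ext x a c
  simp [matDeriv]

/-- Coefficientwise derivative of a loop. -/
def loopDeriv {n : ℕ} (X : Loop n) : Loop n where
  coeff i := matDeriv (X.coeff i)
  isPWO_support' := X.isPWO_support.mono fun i hi h0 => hi (by
    change matDeriv (X.coeff i) = 0
    rw [h0, matDeriv_zero])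

theorem coeff_loopDeriv {n : ℕ} (X : Loop n) (i : ℤ) :
    (loopDeriv X).coeff i = matDeriv (X.coeff i) := rfl

theorem support_loopDeriv_subset {n : ℕ} (X : Loop n) : (loopDeriv X).support ⊆ X.support :=
  fun i hi h0 => hi (by rw [coeff_loopDeriv, h0, matDeriv_zero])

theorem loopDeriv_mul {n : ℕ} {X Y : Loop n} (hX : X ∈ smoothLoops n) (hY : Y ∈ smoothLoops n) :
    loopDeriv (X * Y) = loopDeriv X * Y + X * loopDeriv Y := by
  ext i x a c
  have h1 : (loopDeriv X * Y).coeff i x a c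
      = ∑ p ∈ Finset.antidiagonal X.isPWO_support Y.isPWO_support i,
        ∑ m, deriv (fun y => X.coeff p.1 y a m) x * Y.coeff p.2 x m c := by
    -- Differentiation can only shrink the support, so both terms of the Leibniz rule are written as
    -- sums over the index set of `X * Y`.
    rw [coeff_mul_left' X.isPWO_support (support_loopDeriv_subset X)]
    simp [Finset.sum_apply, Matrix.sum_apply, Matrix.mul_apply, coeff_loopDeriv, matDeriv]
  have h2 : (X * loopDeriv Y).coeff i x a c
      = ∑ p ∈ Finset.antidiagonal X.isPWO_support Y.isPWO_support i,
        ∑ m, X.coeff p.1 x a m * deriv (fun y => Y.coeff p.2 y m c) x := by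
    rw [coeff_mul_right' Y.isPWO_support (support_loopDeriv_subset Y)]
    simp [Finset.sum_apply, Matrix.sum_apply, Matrix.mul_apply, coeff_loopDeriv, matDeriv]
  rw [coeff_add, Pi.add_apply, Matrix.add_apply, h1, h2, ← Finset.sum_add_distrib]
  simp only [← Finset.sum_add_distrib]
  rw [coeff_loopDeriv]
  simp only [matDeriv, Matrix.of_apply, Loop.coeff_mul_apply]
  refine HasDerivAt.deriv ?_
  refine HasDerivAt.fun_sum fun p _ => HasDerivAt.fun_sum fun m _ => ?_
  exact ((hX _).differentiableAt _ _ x).hasDerivAt.mul ((hY _).differentiableAt _ _ x).hasDerivAt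

/-- The principal filtration of the loop algebra: `λ ^ i e_{ac}` has degree `n i + a - c`. -/
def loopFil (n : ℕ) (D : ℤ) : AddSubgroup (smoothLoops n) where
  carrier := {X | ∀ (i : ℤ) (x : ℝ) (a c : Fin n), D < (a : ℤ) - c - n * i → X.1.coeff i x a c = 0}
  add_mem' := by
    intro X Y hX hY i x a c h
    have := hX i x a c h
    have := hY i x a c h
    simp [*]
  zero_mem' := by
    intro i x a c h
    simp
  neg_mem' := by
    intro X hX i x a c h
    have := hX i x a c h
    simp [*]

theorem loopFil_mul_mem {n : ℕ} {D E : ℤ} {X Y : smoothLoops n} (hX : X ∈ loopFil n D)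
    (hY : Y ∈ loopFil n E) : X * Y ∈ loopFil n (D + E) := by
  intro i x a c h
  rw [Subring.coe_mul, Loop.coeff_mul_apply]
  refine Finset.sum_eq_zero fun p hp => Finset.sum_eq_zero fun m _ => ?_
  rw [Finset.mem_antidiagonal] at hp
  by_cases h1 : D < (a : ℤ) - m - n * p.1
  · rw [hX _ _ _ _ h1, zero_mul]
  · rw [hY _ _ _ _ _, mul_zero]
    rw [← hp.2.2] at h
    push Not at h1
    linarith

theorem loopFil_sep {n : ℕ} (X : smoothLoops n) (h : ∀ m : ℕ, X ∈ loopFil n (-m)) : X = 0 := by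
  ext i x a c
  refine h ((n * i + n).toNat) i x a c ?_
  have := Int.self_le_toNat (n * i + n)
  have := c.2
  have := Int.natCast_nonneg (a : ℕ)
  omega

theorem loopFil_complete {n : ℕ} (X : ℕ → smoothLoops n)
    (h : ∀ m : ℕ, X (m + 1) - X m ∈ loopFil n (-m)) :
    ∃ Y, ∀ m : ℕ, Y - X m ∈ loopFil n (-m) := by
  have mono : ∀ {D E : ℤ}, D ≤ E → loopFil n D ≤ loopFil n E :=
    fun hDE X hX i x a c h => hX i x a c (lt_of_le_of_lt hDE h)
  have h1 : ∀ m q : ℕ, X (m + q) - X m ∈ loopFil n (-m) := by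
    intro m q
    induction q with
    | zero => simp
    | succ q ih =>
      have := add_mem (mono (by push_cast; linarith) (h (m + q))) ih
      rw [sub_add_sub_cancel] at this
      exact this
  -- Every entry of coefficient `i` has degree greater than `-(n i + n)`, so it is stationary from
  -- index `k i` on. For `i ≤ -1` this index is `0`, which keeps the support of the limit well
  -- ordered.
  set k : ℤ → ℕ := fun i => (n * i + n).toNat with hk
  have hsupp : (Function.support fun i => (X (k i)).1.coeff i).IsPWO := by
    have hset : ((X 0).1.support ∪ Set.Ici (-1 : ℤ)).IsPWO :=
      (X 0).1.isPWO_support.union (bddBelow_Ici.isWF.isPWO)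
    refine hset.mono fun i hi => ?_
    by_cases hi1 : -1 ≤ i
    · exact Or.inr hi1
    · left
      have h0 : k i = 0 := by
        rw [hk]
        refine Int.toNat_of_nonpos ?_
        have : (n : ℤ) * (i + 1) ≤ 0 :=
          mul_nonpos_of_nonneg_of_nonpos (Int.natCast_nonneg n) (by omega)
        linarith
      rw [Function.mem_support, h0] at hi
      exact hi
  refine ⟨⟨⟨fun i => (X (k i)).1.coeff i, hsupp⟩, fun i => (X (k i)).2 i⟩, fun m => ?_⟩
  intro i x a c hd
  change (X (k i)).1.coeff i x a c - (X m).1.coeff i x a c = 0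
  have hki : -(k i : ℤ) < (a : ℤ) - c - n * i := by
    have := Int.self_le_toNat (n * i + n)
    have := c.2
    have := Int.natCast_nonneg (a : ℕ)
    simp only [hk]
    omega
  rcases le_total m (k i) with hm | hm
  · obtain ⟨q, hq⟩ := Nat.exists_eq_add_of_le hm
    have := h1 m q i x a c hd
    rw [← hq] at this
    exact this
  · obtain ⟨q, hq⟩ := Nat.exists_eq_add_of_le hm
    have := h1 (k i) q i x a c hki
    rw [← hq] at this
    have h3 : (X m).1.coeff i x a c - (X (k i)).1.coeff i x a c = 0 := this
    linarith

/-- The loop `J = e_{1n} λ + b`. -/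
def loopJ (n : ℕ) : Loop n := single (-1) (fun _ => e1n n) + single 0 (fun _ => shift n)

theorem single_mem_smoothLoops {n : ℕ} {i : ℤ} {A : ℝ → Matrix (Fin n) (Fin n) ℝ}
    (hA : MatSmooth A) : single i A ∈ smoothLoops n := by
  intro k a c
  rw [coeff_single]
  split_ifs
  · exact hA a c
  · exact contDiff_const

theorem matSmooth_const {n : ℕ} (M : Matrix (Fin n) (Fin n) ℝ) : MatSmooth fun _ => M :=
  fun _ _ => contDiff_const

theorem loopJ_mem (n : ℕ) : loopJ n ∈ smoothLoops n :=
  add_mem (single_mem_smoothLoops (matSmooth_const _)) (single_mem_smoothLoops (matSmooth_const _))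

/-- `J` is a cyclic shift in which an index that wraps around picks up a factor `λ`; after `n` steps
every index has wrapped once. -/
theorem loopJ_pow_aux (n m : ℕ) (hm : m ≤ n) : loopJ n ^ m =
    single (-1) (fun _ => Matrix.of fun a c : Fin n => if (a : ℕ) + n = c + m then 1 else 0)
      + single 0 (fun _ => Matrix.of fun a c : Fin n => if (a : ℕ) = c + m then 1 else 0) := by
  induction m with
  | zero =>
    have h1 : (Matrix.of fun a c : Fin n => if (a : ℕ) + n = c + 0 then (1 : ℝ) else 0) = 0 := by
      ext a c
      simp; omega
    have h2 : (Matrix.of fun a c : Fin n => if (a : ℕ) = c + 0 then (1 : ℝ) else 0) = 1 := by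
      ext a c
      simp [Matrix.one_apply, Fin.ext_iff]
    rw [h1, h2]
    have : (single (-1) fun _ => 0 : Loop n) = 0 := single_eq_zero
    rw [this, pow_zero, zero_add]
    rfl
  | succ m ih =>
    have h1 : e1n n * (Matrix.of fun a c : Fin n => if (a : ℕ) + n = c + m then (1 : ℝ) else 0)
        = 0 := by
      ext a c
      rw [Matrix.mul_apply]
      refine Finset.sum_eq_zero fun l _ => ?_
      simp [e1n]; omega
    have h2 : e1n n * (Matrix.of fun a c : Fin n => if (a : ℕ) = c + m then (1 : ℝ) else 0)
        + shift n * (Matrix.of fun a c : Fin n => if (a : ℕ) + n = c + m then (1 : ℝ) else 0)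
        = Matrix.of fun a c : Fin n => if (a : ℕ) + n = c + (m + 1) then (1 : ℝ) else 0 := by
      ext a c
      rw [Matrix.add_apply, Matrix.mul_apply, Matrix.mul_apply, ← Finset.sum_add_distrib]
      by_cases ha : (a : ℕ) = 0
      · rw [Finset.sum_eq_single ⟨n - 1, by omega⟩]
        · simp [e1n, shift, ha]
          grind
        · intro l _ hl
          have hl' : ¬ (l : ℕ) = n - 1 := fun h => hl (Fin.ext h)
          have hl2 : ¬ (l : ℕ) + 1 = n := by omega
          simp [e1n, shift, ha, hl2]
        · simp
      · rw [Finset.sum_eq_single ⟨a - 1, by omega⟩]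
        · simp [e1n, shift, ha]
          grind
        · intro l _ hl
          have hl' : ¬ (l : ℕ) = a - 1 := fun h => hl (Fin.ext h)
          have hl2 : ¬ (a : ℕ) = l + 1 := by omega
          simp [e1n, shift, ha, hl2]
        · simp
    have h3 : shift n * (Matrix.of fun a c : Fin n => if (a : ℕ) = c + m then (1 : ℝ) else 0)
        = Matrix.of fun a c : Fin n => if (a : ℕ) = c + (m + 1) then (1 : ℝ) else 0 := by
      ext a c
      rw [Matrix.mul_apply]
      by_cases ha : (a : ℕ) = 0
      · rw [Finset.sum_eq_zero]
        · simp [ha]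
        · intro l _
          simp [shift, ha]
      · rw [Finset.sum_eq_single ⟨a - 1, by omega⟩]
        · simp [shift]
          grind
        · intro l _ hl
          have hl' : ¬ (l : ℕ) = a - 1 := fun h => hl (Fin.ext h)
          have hl2 : ¬ (a : ℕ) = l + 1 := by omega
          simp [shift, hl2]
        · simp
    rw [pow_succ', ih (by omega), loopJ, ← h3, ← h2]
    simp only [add_mul, mul_add, single_mul_single]
    have h4 : (fun _ : ℝ => e1n n) * (fun _ => Matrix.of fun a c : Fin n =>
        if (a : ℕ) + n = c + m then (1 : ℝ) else 0) = 0 := funext fun _ => h1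
    rw [h4]
    simp only [map_zero, zero_add, add_zero]
    have h5 : ∀ A B : ℝ → Matrix (Fin n) (Fin n) ℝ,
        (single (-1) A : Loop n) + single (-1) B = single (-1) (B + A) := fun A B => by
      rw [← single_add, add_comm]
    rw [← add_assoc, h5]
    rfl

theorem loopJ_pow (n : ℕ) : loopJ n ^ n = single (-1) 1 := by
  rw [loopJ_pow_aux n n le_rfl]
  have h1 : (Matrix.of fun a c : Fin n => if (a : ℕ) + n = c + n then (1 : ℝ) else 0) = 1 := by
    ext a c
    simp [Matrix.one_apply, Fin.ext_iff]
  have h2 : (Matrix.of fun a c : Fin n => if (a : ℕ) = c + n then (1 : ℝ) else 0) = 0 := by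
    ext a c
    simp; omega
  rw [h1, h2]
  have : (single 0 fun _ => 0 : Loop n) = 0 := single_eq_zero
  rw [this, add_zero]
  rfl

theorem loopDeriv_loopJ (n : ℕ) : loopDeriv (loopJ n) = 0 := by
  ext i x a c
  rw [coeff_loopDeriv]
  have : (loopJ n).coeff i = fun _ => (loopJ n).coeff i 0 := by
    rw [loopJ, coeff_add, coeff_single, coeff_single]
    split_ifs <;> rfl
  rw [this, matDeriv_const]
  rfl

/-- The loop `λ⁻¹ / n`. -/
def loopW (n : ℕ) : Loop n := single 1 (fun _ => (n : ℝ)⁻¹ • 1)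

theorem loopW_comm (n : ℕ) (X : Loop n) : loopW n * X = X * loopW n := by
  ext i x a c
  rw [loopW, coeff_single_mul, coeff_mul_single]
  simp

theorem loopW_mul (n : ℕ) (hn : n ≠ 0) : n • (loopW n * loopJ n ^ n) = 1 := by
  rw [loopJ_pow, loopW, single_mul_single]
  change n • HahnSeries.single.addMonoidHom _ _ = _
  rw [← map_nsmul]
  have : (n • ((fun _ : ℝ => (n : ℝ)⁻¹ • (1 : Matrix (Fin n) (Fin n) ℝ)) * 1)) = 1 := by
    ext x a c
    have : (n : ℝ) ≠ 0 := by exact_mod_cast hn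
    simp [this]
  rw [this]
  rfl

/-- Smooth loops with the principal filtration. -/
def loopFDR (n : ℕ) (hn : n ≠ 0) : FiltDiffRing n (smoothLoops n) where
  F := loopFil n
  mono := fun hDE X hX i x a c h => hX i x a c (lt_of_le_of_lt hDE h)
  mul_mem := loopFil_mul_mem
  sep := loopFil_sep
  complete := loopFil_complete
  J := ⟨loopJ n, loopJ_mem n⟩
  J_mem := by
    intro i x a c h
    simp only [loopJ, coeff_add, coeff_single, Pi.add_apply, Matrix.add_apply]
    by_cases h1 : i = -1
    · subst h1
      simp [e1n]
      omega
    · by_cases h0 : i = 0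
      · subst h0
        simp [shift]
        omega
      · simp [h1, h0]
  J_comm := by
    intro X
    ext i x a c
    simp only [Subring.coe_mul, SubmonoidClass.coe_pow, loopJ_pow]
    rw [coeff_single_mul, coeff_mul_single, one_mul, mul_one]
  w := ⟨loopW n, single_mem_smoothLoops (matSmooth_const _)⟩
  w_mem := by
    intro i x a c h
    simp only [loopW, coeff_single]
    split_ifs with hi
    · subst hi
      have : a ≠ c := by
        rintro rfl
        omega
      simp [this]
    · rfl
  w_comm := fun X => Subtype.ext (loopW_comm n X)
  w_J := Subtype.ext (by
    simpa using loopW_mul n hn)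
  δ :=
    { toFun := fun X => ⟨loopDeriv X.1, fun i => (X.2 i).matDeriv⟩
      map_zero' := Subtype.ext (by
        ext i x a c
        change matDeriv (0 : ℝ → Matrix (Fin n) (Fin n) ℝ) x a c = 0
        rw [matDeriv_zero]; rfl)
      map_add' := fun X Y => Subtype.ext (by
        ext i x a c
        exact deriv_fun_add ((X.2 i).differentiableAt a c x) ((Y.2 i).differentiableAt a c x)) }
  leibniz := fun X Y => Subtype.ext (loopDeriv_mul X.2 Y.2)
  δ_mem := by
    intro D X hX i x a c h
    have : (fun y => X.1.coeff i y a c) = fun _ => 0 := funext fun y => hX i y a c h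
    change deriv (fun y => X.1.coeff i y a c) x = 0
    rw [this]
    simp
  δ_J := Subtype.ext (loopDeriv_loopJ n)

/-! ### The series `Y(u, λ)` and its behaviour under gauge transformations. -/

/-- The matrix `b + u` of the moving frame equation `g_x = g (b + u)`. -/
def conn (n : ℕ) (u : ℕ → ℝ → ℝ) (x : ℝ) : Matrix (Fin n) (Fin n) ℝ := shift n + potential n u x

theorem matSmooth_conn {n : ℕ} {u : ℕ → ℝ → ℝ} (hu : ∀ i, ContDiff ℝ ∞ (u i)) :
    MatSmooth (conn n u) := by
  intro a c
  simp only [conn, Matrix.add_apply, potential, Matrix.of_apply]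
  split_ifs
  · exact contDiff_const.add (hu _)
  · exact contDiff_const

theorem laxLoop_mem {n : ℕ} {u : ℕ → ℝ → ℝ} (hu : ∀ i, ContDiff ℝ ∞ (u i)) :
    laxLoop n u ∈ smoothLoops n :=
  add_mem (single_mem_smoothLoops (matSmooth_const _)) (single_mem_smoothLoops (matSmooth_conn hu))

theorem coeff_affine_mul {n : ℕ} (M : Matrix (Fin n) (Fin n) ℝ) (A : ℝ → Matrix (Fin n) (Fin n) ℝ)
    (X : Loop n) (i : ℤ) (x : ℝ) :
    ((single (-1) (fun _ => M) + single 0 A) * X).coeff i x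
      = M * X.coeff (i + 1) x + A x * X.coeff i x := by
  rw [add_mul, coeff_add, coeff_single_mul, coeff_single_mul, sub_neg_eq_add, sub_zero]
  rfl

theorem coeff_mul_affine {n : ℕ} (M : Matrix (Fin n) (Fin n) ℝ) (A : ℝ → Matrix (Fin n) (Fin n) ℝ)
    (X : Loop n) (i : ℤ) (x : ℝ) :
    (X * (single (-1) (fun _ => M) + single 0 A)).coeff i x
      = X.coeff (i + 1) x * M + X.coeff i x * A x := by
  rw [mul_add, coeff_add, coeff_mul_single, coeff_mul_single, sub_neg_eq_add, sub_zero]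
  rfl

theorem coeff_lax {n : ℕ} (u : ℕ → ℝ → ℝ) (X : Loop n) (i : ℤ) (x : ℝ) :
    matDeriv (X.coeff i) x + (laxLoop n u * X - X * laxLoop n u).coeff i x
      = matDeriv (X.coeff i) x + (e1n n * X.coeff (i + 1) x + conn n u x * X.coeff i x)
        - (X.coeff (i + 1) x * e1n n + X.coeff i x * conn n u x) := by
  rw [coeff_sub, Pi.sub_apply, laxLoop, coeff_affine_mul, coeff_mul_affine]
  exact (add_sub_assoc _ _ _).symm

/-- `laxLoop` as a smooth loop. -/
def smoothLax (n : ℕ) (u : ℕ → ℝ → ℝ) (hu : ∀ i, ContDiff ℝ ∞ (u i)) : smoothLoops n :=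
  ⟨laxLoop n u, laxLoop_mem hu⟩

theorem smoothLax_sub_J {n : ℕ} (hn : n ≠ 0) {u : ℕ → ℝ → ℝ} (hu : ∀ i, ContDiff ℝ ∞ (u i)) :
    smoothLax n u hu - (loopFDR n hn).J ∈ (loopFDR n hn).F 0 := by
  intro i x a c h
  change (laxLoop n u - loopJ n).coeff i x a c = 0
  have h1 : laxLoop n u - loopJ n = single 0 (potential n u) := by
    have h2 : (single 0 (fun x => shift n + potential n u x) : Loop n)
        = single 0 (fun _ => shift n) + single 0 (potential n u) := by
      rw [← single_add]; rfl
    rw [laxLoop, loopJ, h2]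
    abel
  rw [h1, coeff_single]
  split_ifs with h0
  · subst h0
    have := a.2
    simp only [potential, Matrix.of_apply]
    rw [if_neg]
    omega
  · rfl

theorem lax_eq_zero_iff {n : ℕ} (hn : n ≠ 0) {u : ℕ → ℝ → ℝ} (hu : ∀ i, ContDiff ℝ ∞ (u i))
    (X : smoothLoops n) : (loopFDR n hn).lax (smoothLax n u hu) (smoothLax n u hu) X = 0 ↔
      ∀ (i : ℤ) (x : ℝ),
        matDeriv (X.1.coeff i) x + (laxLoop n u * X.1 - X.1 * laxLoop n u).coeff i x = 0 := by
  have h : ∀ i x, ((loopFDR n hn).lax (smoothLax n u hu) (smoothLax n u hu) X).1.coeff i x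
      = matDeriv (X.1.coeff i) x + (laxLoop n u * X.1 - X.1 * laxLoop n u).coeff i x := by
    intro i x
    change (loopDeriv X.1 + laxLoop n u * X.1 - X.1 * laxLoop n u).coeff i x = _
    rw [add_sub_assoc]
    rfl
  constructor
  · intro h0 i x
    rw [← h, h0]
    rfl
  · intro h0
    refine Subtype.ext (HahnSeries.ext (funext fun i => funext fun x => ?_))
    rw [h, h0]
    rfl

/-- The traces of the coefficients of a loop. -/
def loopTrace (n : ℕ) : smoothLoops n →+ (ℤ → ℝ → ℝ) where
  toFun X i x := (X.1.coeff i x).trace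
  map_zero' := by
    ext i x
    simp
  map_add' X Y := by
    ext i x
    simp

theorem loopTrace_mul_comm {n : ℕ} (X Y : smoothLoops n) :
    loopTrace n (X * Y) = loopTrace n (Y * X) := by
  ext i x
  change ((X.1 * Y.1).coeff i x).trace = ((Y.1 * X.1).coeff i x).trace
  rw [coeff_mul, coeff_mul, Finset.sum_apply, Finset.sum_apply, Matrix.trace_sum, Matrix.trace_sum]
  refine Finset.sum_nbij' Prod.swap Prod.swap ?_ ?_ ?_ ?_ ?_
  · intro p hp
    rw [Finset.mem_antidiagonal] at hp ⊢
    exact ⟨hp.2.1, hp.1, by rw [← hp.2.2]; exact add_comm _ _⟩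
  · intro p hp
    rw [Finset.mem_antidiagonal] at hp ⊢
    exact ⟨hp.2.1, hp.1, by rw [← hp.2.2]; exact add_comm _ _⟩
  · intro p _; rfl
  · intro p _; rfl
  · intro p _
    exact Matrix.trace_mul_comm _ _

theorem trace_e1n {n : ℕ} (hn : 2 ≤ n) : (e1n n).trace = 0 := by
  refine Finset.sum_eq_zero fun a _ => ?_
  simp [e1n]
  omega

theorem trace_shift {n : ℕ} : (shift n).trace = 0 := by
  refine Finset.sum_eq_zero fun a _ => ?_
  simp [shift]

/-- The series `Y(u, λ)` exists. -/
theorem exists_isY {n : ℕ} (hn : 2 ≤ n) {u : ℕ → ℝ → ℝ} (hu : ∀ i, ContDiff ℝ ∞ (u i)) :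
    ∃ Y, IsY n u Y := by
  have hn0 : n ≠ 0 := by omega
  obtain ⟨Y, hYJ, hlax, hpow⟩ := (loopFDR n hn0).exists_root hn0 (smoothLax_sub_J hn0 hu)
  have hcoeff : ∀ (i : ℤ) (x : ℝ) (a c : Fin n), 0 < (a : ℤ) - c - n * i →
      Y.1.coeff i x a c = (loopJ n).coeff i x a c := fun i x a c h =>
    sub_eq_zero.1 (hYJ i x a c h)
  refine ⟨Y.1, Y.2, ?_, (lax_eq_zero_iff hn0 hu Y).1 hlax, ?_, ?_, ?_⟩
  · intro i x
    -- The diagonal entries of coefficient `i` have degree `-n i`, so a remainder of degree at most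
    -- `-(n i + 1)` does not contribute to the trace.
    obtain ⟨Z, hZ, h⟩ := (loopFDR n hn0).exists_trace_eq hn0 (loopTrace n) loopTrace_mul_comm
      hYJ hpow (n * i + 1).toNat
    have h1 : loopTrace n Y i x = ((loopJ n).coeff i x).trace + (Z.1.coeff i x).trace := by
      rw [h]; rfl
    have h2 : (Z.1.coeff i x).trace = 0 := by
      refine Finset.sum_eq_zero fun a _ => hZ i x a a ?_
      have := Int.self_le_toNat (n * i + 1)
      omega
    have h3 : ((loopJ n).coeff i x).trace = 0 := by
      rw [loopJ, coeff_add, coeff_single, coeff_single]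
      split_ifs <;> simp [trace_e1n hn, trace_shift]
    change loopTrace n Y i x = 0
    rw [h1, h2, h3, add_zero]
  · have := congrArg Subtype.val hpow
    rw [SubmonoidClass.coe_pow] at this
    rw [this]
    exact loopJ_pow n
  · ext x a c
    rw [hcoeff _ _ _ _ (by have := c.2; omega)]
    simp [loopJ]
  · intro i hi
    ext x a c
    have h0 : (n : ℤ) * (i + 2) ≤ 0 :=
      mul_nonpos_of_nonneg_of_nonpos (Int.natCast_nonneg n) (by omega)
    rw [hcoeff _ _ _ _ (by have := c.2; linarith)]
    simp [loopJ, show ¬ i = -1 by omega, show ¬ i = 0 by omega]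

theorem isY_Y {n : ℕ} (hn : 2 ≤ n) {u : ℕ → ℝ → ℝ} (hu : ∀ i, ContDiff ℝ ∞ (u i)) :
    IsY n u (Y n u) := by
  rw [Y, dif_pos (exists_isY hn hu)]
  exact (exists_isY hn hu).choose_spec

theorem e1n_mul_apply {n : ℕ} (M : Matrix (Fin n) (Fin n) ℝ) (a c : Fin n) :
    (e1n n * M) a c = if (a : ℕ) = 0 then M ⟨n - 1, by have := a.2; omega⟩ c else 0 := by
  rw [Matrix.mul_apply, Finset.sum_eq_single ⟨n - 1, by have := a.2; omega⟩]
  · have : n - 1 + 1 = n := by have := a.2; omega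
    simp [e1n, this]
  · intro l _ hl
    have hl' : ¬ (l : ℕ) = n - 1 := fun h => hl (Fin.ext h)
    have hl2 : ¬ (l : ℕ) + 1 = n := by omega
    simp [e1n, hl2]
  · simp

theorem mul_e1n_apply {n : ℕ} (M : Matrix (Fin n) (Fin n) ℝ) (a c : Fin n) :
    (M * e1n n) a c = if (c : ℕ) + 1 = n then M a ⟨0, by have := a.2; omega⟩ else 0 := by
  rw [Matrix.mul_apply, Finset.sum_eq_single ⟨0, by have := a.2; omega⟩]
  · simp [e1n]
  · intro l _ hl
    have hl' : ¬ (l : ℕ) = 0 := fun h => hl (Fin.ext h)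
    simp [e1n, hl']
  · simp

theorem shift_mul_apply {n : ℕ} (M : Matrix (Fin n) (Fin n) ℝ) (a c : Fin n) :
    (shift n * M) a c = if (a : ℕ) = 0 then 0 else M ⟨a - 1, by have := a.2; omega⟩ c := by
  rw [Matrix.mul_apply, Finset.sum_eq_single ⟨a - 1, by have := a.2; omega⟩]
  · by_cases ha : (a : ℕ) = 0
    · simp [shift, ha]
    · have : (a : ℕ) = a - 1 + 1 := by omega
      simp [shift, ha, ← this]
  · intro l _ hl
    have hl' : ¬ (l : ℕ) = a - 1 := fun h => hl (Fin.ext h)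
    have hl2 : ¬ (a : ℕ) = l + 1 := by omega
    simp [shift, hl2]
  · simp

theorem mul_shift_apply {n : ℕ} (M : Matrix (Fin n) (Fin n) ℝ) (a c : Fin n) :
    (M * shift n) a c = if h : (c : ℕ) + 1 < n then M a ⟨c + 1, h⟩ else 0 := by
  rw [Matrix.mul_apply]
  split_ifs with h
  · rw [Finset.sum_eq_single ⟨c + 1, h⟩]
    · simp [shift]
    · intro l _ hl
      have hl' : ¬ (l : ℕ) = c + 1 := fun h => hl (Fin.ext h)
      simp [shift, hl']
    · simp
  · refine Finset.sum_eq_zero fun l _ => ?_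
    have hl : ¬ (l : ℕ) = c + 1 := by have := l.2; omega
    simp [shift, hl]

theorem potential_mul_apply {n : ℕ} (u : ℕ → ℝ → ℝ) (x : ℝ) (M : Matrix (Fin n) (Fin n) ℝ)
    (a c : Fin n) : (potential n u x * M) a c =
      if (a : ℕ) + 1 < n then u (a + 1) x * M ⟨n - 1, by have := a.2; omega⟩ c else 0 := by
  rw [Matrix.mul_apply, Finset.sum_eq_single ⟨n - 1, by have := a.2; omega⟩]
  · have : n - 1 + 1 = n := by have := a.2; omega
    simp [potential, this]
  · intro l _ hl
    have hl' : ¬ (l : ℕ) = n - 1 := fun h => hl (Fin.ext h)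
    have hl2 : ¬ (l : ℕ) + 1 = n := by omega
    simp [potential, hl2]
  · simp

theorem mul_potential_apply_of_lt {n : ℕ} (u : ℕ → ℝ → ℝ) (x : ℝ) (M : Matrix (Fin n) (Fin n) ℝ)
    (a c : Fin n) (hc : (c : ℕ) + 1 < n) : (M * potential n u x) a c = 0 := by
  rw [Matrix.mul_apply]
  refine Finset.sum_eq_zero fun l _ => ?_
  have : ¬ (c : ℕ) + 1 = n := by omega
  simp [potential, this]

/-- Any admissible `Y` has the form `J + (terms of lower degree)`. -/
theorem IsY.coeff_zero_apply {n : ℕ} (hn : 2 ≤ n) {u : ℕ → ℝ → ℝ} {Y : Loop n} (hY : IsY n u Y)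
    (c : ℕ) : ∀ (x : ℝ) (a c' : Fin n), (c' : ℕ) = c → c' < a →
      Y.coeff 0 x a c' = shift n a c' := by
  -- The coefficient of `λ^1` (index `-1`) of the Lax equation. Its last column determines the first
  -- column of `Y_0` below the diagonal, and its first row determines the last row of `Y_0` except
  -- for the last entry.
  have h1 : ∀ x, e1n n * Y.coeff 0 x + conn n u x * e1n n
      = Y.coeff 0 x * e1n n + e1n n * conn n u x := by
    intro x
    have := hY.commutes (-1) x
    rw [coeff_lax, hY.lead, matDeriv_const] at this
    simpa [sub_eq_zero] using this
  induction c with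
  | zero =>
    intro x a c' hc ha
    have ha0 : ¬ (a : ℕ) = 0 := by
      have : (c' : ℕ) < a := ha
      omega
    have h2 := congrFun (congrFun (h1 x) a) ⟨n - 1, by omega⟩
    simp only [Matrix.add_apply, e1n_mul_apply, mul_e1n_apply, if_neg ha0,
      show n - 1 + 1 = n by omega, if_true, zero_add, add_zero] at h2
    have h0 : (⟨0, by omega⟩ : Fin n) = c' := Fin.ext hc.symm
    rw [h0] at h2
    rw [← h2, conn, Matrix.add_apply, potential, Matrix.of_apply, if_neg, add_zero]
    omega
  | succ c ih =>
    intro x a c' hc ha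
    have hac : (c' : ℕ) < a := ha
    have ha0 : ¬ (a : ℕ) = 0 := by omega
    have hcn : c + 1 < n := by have := c'.2; omega
    have hlast : Y.coeff 0 x ⟨n - 1, by omega⟩ ⟨c, by omega⟩
        = conn n u x ⟨n - 1, by omega⟩ ⟨c, by omega⟩ := by
      have h2 := congrFun (congrFun (h1 x) ⟨0, by omega⟩) ⟨c, by omega⟩
      simpa [Matrix.add_apply, e1n_mul_apply, mul_e1n_apply, show ¬ c + 1 = n by omega] using h2
    -- The induction runs along columns: entry `(a, c)` of the `λ^0` equation expresses `Y_0` at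
    -- `(a, c + 1)` through column `c`, whose entries below the diagonal are constant.
    have hd : matDeriv (Y.coeff 0) x a ⟨c, by omega⟩ = 0 := by
      have : (fun y => Y.coeff 0 y a ⟨c, by omega⟩) = fun _ => shift n a ⟨c, by omega⟩ :=
        funext fun y => ih y a ⟨c, by omega⟩ rfl (by change c < (a : ℕ); omega)
      simp [matDeriv, this]
    have h2 := congrFun (congrFun (hY.commutes 0 x) a) ⟨c, by omega⟩
    rw [coeff_lax] at h2
    simp only [Matrix.add_apply, Matrix.sub_apply, e1n_mul_apply, mul_e1n_apply, if_neg ha0,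
      if_neg (show ¬ c + 1 = n by omega), conn, add_mul, mul_add, hd, shift_mul_apply,
      mul_shift_apply, potential_mul_apply, zero_add, hlast, dif_pos hcn,
      mul_potential_apply_of_lt u x _ a ⟨c, by omega⟩ hcn, add_zero, Matrix.zero_apply] at h2
    have hp : potential n u x ⟨n - 1, by omega⟩ ⟨c, by omega⟩ = 0 := by
      simp [potential]; omega
    have hs : shift n ⟨n - 1, by omega⟩ ⟨c, by omega⟩ = if c + 2 = n then 1 else 0 := by
      simp only [shift, Matrix.of_apply]
      congr 1
      simp only [eq_iff_iff]
      omega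
    -- The last row of column `c` is non-zero only if `c + 2 = n`, but then `c + 1 < a` leaves no
    -- such row `a`.
    have hz : (if (a : ℕ) + 1 < n then u (a + 1) x * (if c + 2 = n then (1 : ℝ) else 0) else 0)
        = 0 := by
      split_ifs <;> first | omega | simp
    rw [hp, mul_zero, add_zero, hs, hz, add_zero, ih x ⟨a - 1, by omega⟩ ⟨c, by omega⟩ rfl
      (by change c < (a : ℕ) - 1; omega)] at h2
    have h0 : (⟨c + 1, hcn⟩ : Fin n) = c' := Fin.ext hc.symm
    rw [h0, sub_eq_zero] at h2
    rw [← h2]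
    simp only [shift, Matrix.of_apply]
    congr 1
    simp only [eq_iff_iff]
    omega

/-- The normalization prescribes only the coefficient of `λ`; the Lax equation fixes the part of the
`λ^0` coefficient of positive degree. Rigidity therefore applies to every admissible `Y`, including
the chosen one. -/
theorem IsY.sub_J_mem {n : ℕ} (hn : 2 ≤ n) (hn0 : n ≠ 0) {u : ℕ → ℝ → ℝ} {Y : Loop n}
    (hY : IsY n u Y) : (⟨Y, hY.smooth⟩ : smoothLoops n) - (loopFDR n hn0).J
      ∈ (loopFDR n hn0).F 0 := by
  intro i x a c h
  change Y.coeff i x a c - (loopJ n).coeff i x a c = 0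
  rw [sub_eq_zero]
  simp only [loopJ, coeff_add, coeff_single]
  by_cases h1 : i < -1
  · rw [hY.bounded i h1]
    simp [show ¬ i = -1 by omega, show ¬ i = 0 by omega]
  · by_cases h2 : i = -1
    · subst h2
      rw [hY.lead]
      simp
    · by_cases h3 : i = 0
      · subst h3
        rw [hY.coeff_zero_apply hn c x a c rfl (by
          change (c : ℕ) < a
          omega)]
        simp
      · exfalso
        have : (n : ℤ) * 1 ≤ n * i := mul_le_mul_of_nonneg_left (by omega) (Int.natCast_nonneg n)
        have := a.2
        omega

theorem IsY.pow_eq_J {n : ℕ} (hn0 : n ≠ 0) {u : ℕ → ℝ → ℝ} {Y : Loop n} (hY : IsY n u Y) :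
    (⟨Y, hY.smooth⟩ : smoothLoops n) ^ n = (loopFDR n hn0).J ^ n := by
  refine Subtype.ext ?_
  rw [SubmonoidClass.coe_pow, SubmonoidClass.coe_pow]
  exact hY.pow_eq.trans (loopJ_pow n).symm

/-- This is the `λ^0` coefficient of `[∂_x + J + u, Y ^ j] = 0`, where only `λ e_{1n}` meets the
coefficient of `λ⁻¹`. The resulting commutator with `e_{1n}` lives in the first row and the last
column. -/
theorem IsY.bracket_pow {n : ℕ} (hn0 : n ≠ 0) {u : ℕ → ℝ → ℝ} (hu : ∀ i, ContDiff ℝ ∞ (u i))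
    {Y : Loop n} (hY : IsY n u Y) (j : ℕ) (x : ℝ) :
    bracket n u ((Y ^ j).coeff 0) x
      = (Y ^ j).coeff 1 x * e1n n - e1n n * (Y ^ j).coeff 1 x := by
  have h1 : (loopFDR n hn0).lax (smoothLax n u hu) (smoothLax n u hu) ⟨Y, hY.smooth⟩ = 0 :=
    (lax_eq_zero_iff hn0 hu _).2 hY.commutes
  have h2 := (lax_eq_zero_iff hn0 hu _).1 ((loopFDR n hn0).lax_pow _ _ h1 j) 0 x
  rw [coeff_lax] at h2
  rw [SubmonoidClass.coe_pow] at h2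
  change matDeriv ((Y ^ j).coeff 0) x + conn n u x * (Y ^ j).coeff 0 x
    - (Y ^ j).coeff 0 x * conn n u x = _
  rw [← sub_eq_zero, ← h2]
  simp only [zero_add]
  abel

/-- A first order gauge transformation from `u` to `v` intertwines `Y(u, λ)` and `Y(v, λ)`. -/
theorem IsY.gauge {n : ℕ} (hn : 2 ≤ n) {u v : ℕ → ℝ → ℝ} (hu : ∀ i, ContDiff ℝ ∞ (u i))
    (hv : ∀ i, ContDiff ℝ ∞ (v i)) {Yu Yv : Loop n} (hYu : IsY n u Yu) (hYv : IsY n v Yv)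
    {f : ℝ → Matrix (Fin n) (Fin n) ℝ} (hf : MatSmooth f)
    (hf0 : ∀ (x : ℝ) (a c : Fin n), (c : ℕ) + 1 < a → f x a c = 0)
    (h1 : ∀ x, e1n n * f x + conn n v x * e1n n = f x * e1n n + e1n n * conn n u x)
    (h0 : ∀ x, matDeriv f x = f x * conn n u x - conn n v x * f x) (j : ℕ) (x : ℝ) :
    f x * (Yu ^ j).coeff 0 x - (Yv ^ j).coeff 0 x * f x
      = (Yv ^ j).coeff 1 x * e1n n - e1n n * (Yu ^ j).coeff 1 x := by
  have hn0 : n ≠ 0 := by omega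
  have hfm : (single (-1) (fun _ => e1n n) + single 0 f : Loop n) ∈ smoothLoops n :=
    add_mem (single_mem_smoothLoops (matSmooth_const _)) (single_mem_smoothLoops hf)
  set fl : smoothLoops n := ⟨single (-1) (fun _ => e1n n) + single 0 f, hfm⟩ with hfl
  have hcf : ∀ i, fl.1.coeff i = (if i = -1 then (fun _ => e1n n : ℝ → Matrix (Fin n) (Fin n) ℝ) else 0) + if i = 0 then f else 0 :=
    fun i => by
      rw [hfl]
      simp only [coeff_add, coeff_single]
      split_ifs <;> rfl
  have key : fl * ⟨Yu, hYu.smooth⟩ = ⟨Yv, hYv.smooth⟩ * fl := by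
    refine (loopFDR n hn0).intertwine hn0 (hYv.sub_J_mem hn hn0) (hYu.sub_J_mem hn hn0)
      (smoothLax_sub_J hn0 hu) (smoothLax_sub_J hn0 hv) ?_ (hYv.pow_eq_J hn0) (hYu.pow_eq_J hn0)
      ((lax_eq_zero_iff hn0 hv _).2 hYv.commutes) ((lax_eq_zero_iff hn0 hu _).2 hYu.commutes) ?_
    · intro i y a c h
      rw [hcf]
      by_cases h1 : i = -1
      · subst h1
        simp [e1n]
        omega
      · by_cases h2 : i = 0
        · subst h2
          simpa using hf0 y a c (by omega)
        · simp [h1, h2]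
    · refine Subtype.ext (HahnSeries.ext (funext fun i => funext fun y => ?_))
      change (loopDeriv fl.1 + laxLoop n v * fl.1 - fl.1 * laxLoop n u).coeff i y = 0
      rw [coeff_sub, coeff_add, Pi.sub_apply, Pi.add_apply, laxLoop, laxLoop, coeff_affine_mul,
        coeff_mul_affine, coeff_loopDeriv, hcf, hcf]
      change _ + (_ + conn n v y * _) - (_ + _ * conn n u y) = 0
      by_cases hi : i = -1
      · subst hi
        have := h1 y
        simp [matDeriv_const, this]
      · by_cases hi0 : i = 0
        · subst hi0
          have := h0 y
          simp [this]
        · by_cases hi2 : i = -2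
          · subst hi2
            simp [matDeriv_zero]
          · simp [hi, hi0, matDeriv_zero, show ¬ i + 1 = -1 by omega, show ¬ i + 1 = 0 by omega]
  have keyj : ∀ j : ℕ, fl.1 * Yu ^ j = Yv ^ j * fl.1 := by
    have key' : fl.1 * Yu = Yv * fl.1 := congrArg Subtype.val key
    intro j
    induction j with
    | zero => simp
    | succ j ih => rw [pow_succ, ← mul_assoc, ih, mul_assoc, key', ← mul_assoc, ← pow_succ]
  -- Compare the coefficients of `λ^0` in the intertwining relation for the `j`-th powers.
  have h2 := congrFun (congrArg (fun X => HahnSeries.coeff X 0) (keyj j)) x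
  simp only [hfl] at h2
  rw [coeff_affine_mul, coeff_mul_affine, zero_add] at h2
  rw [sub_eq_sub_iff_add_eq_add, add_comm, h2, add_comm]

/-! ### The correction `ζ_j` and the matrices `Z_{j,0}`. -/

theorem matSmooth_Yj0 {n : ℕ} (hn : 2 ≤ n) {u : ℕ → ℝ → ℝ} (hu : ∀ i, ContDiff ℝ ∞ (u i))
    (j : ℕ) : MatSmooth (Yj0 n j u) :=
  pow_mem (S := smoothLoops n) (show Y n u ∈ smoothLoops n from (isY_Y hn hu).smooth) j 0

theorem MatSmooth.mul {n : ℕ} {A B : ℝ → Matrix (Fin n) (Fin n) ℝ} (hA : MatSmooth A)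
    (hB : MatSmooth B) : MatSmooth fun x => A x * B x := by
  intro a c
  simp only [Matrix.mul_apply]
  exact ContDiff.sum fun l _ => (hA a l).mul (hB l c)

theorem MatSmooth.sub {n : ℕ} {A B : ℝ → Matrix (Fin n) (Fin n) ℝ} (hA : MatSmooth A)
    (hB : MatSmooth B) : MatSmooth fun x => A x - B x :=
  fun a c => (hA a c).sub (hB a c)

theorem matSmooth_bracket {n : ℕ} {u : ℕ → ℝ → ℝ} (hu : ∀ i, ContDiff ℝ ∞ (u i))
    {C : ℝ → Matrix (Fin n) (Fin n) ℝ} (hC : MatSmooth C) : MatSmooth (bracket n u C) :=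
  fun a c => ((hC.matDeriv a c).add (((matSmooth_conn hu).mul hC) a c)).sub
    ((hC.mul (matSmooth_conn hu)) a c)

theorem bracket_sub {n : ℕ} (u : ℕ → ℝ → ℝ) {C D : ℝ → Matrix (Fin n) (Fin n) ℝ}
    (hC : MatSmooth C) (hD : MatSmooth D) (x : ℝ) :
    bracket n u (fun y => C y - D y) x = bracket n u C x - bracket n u D x := by
  have h : matDeriv (fun y => C y - D y) x = matDeriv C x - matDeriv D x := by
    ext a c
    exact deriv_fun_sub (hC.differentiableAt a c x) (hD.differentiableAt a c x)
  simp only [bracket, h, mul_sub, sub_mul]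
  abel

theorem conn_mul_apply {n : ℕ} (u : ℕ → ℝ → ℝ) (x : ℝ) (M : Matrix (Fin n) (Fin n) ℝ)
    (a c : Fin n) : (conn n u x * M) a c =
      (if (a : ℕ) = 0 then 0 else M ⟨a - 1, by have := a.2; omega⟩ c)
        + if (a : ℕ) + 1 < n then u (a + 1) x * M ⟨n - 1, by have := a.2; omega⟩ c else 0 := by
  rw [conn, add_mul, Matrix.add_apply, shift_mul_apply, potential_mul_apply]

theorem mul_conn_apply_of_lt {n : ℕ} (u : ℕ → ℝ → ℝ) (x : ℝ) (M : Matrix (Fin n) (Fin n) ℝ)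
    (a c : Fin n) (hc : (c : ℕ) + 1 < n) : (M * conn n u x) a c = M a ⟨c + 1, hc⟩ := by
  rw [conn, mul_add, Matrix.add_apply, mul_shift_apply, mul_potential_apply_of_lt u x M a c hc,
    add_zero, dif_pos hc]

theorem bracket_apply_of_lt {n : ℕ} (u : ℕ → ℝ → ℝ) (C : ℝ → Matrix (Fin n) (Fin n) ℝ) (x : ℝ)
    (a c : Fin n) (hc : (c : ℕ) + 1 < n) : bracket n u C x a c
      = deriv (fun y => C y a c) x + (conn n u x * C x) a c - C x a ⟨c + 1, hc⟩ := by
  rw [← mul_conn_apply_of_lt u x (C x) a c hc]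
  rfl

/-- The columns of the strictly upper triangular matrix `ζ` for which `[∂_x + b + u, ζ]` has the
first row `β`, up to the last column, and vanishing other rows. -/
def upperColumn (n : ℕ) (u : ℕ → ℝ → ℝ) (β : ℕ → ℝ → ℝ) : ℕ → Fin n → ℝ → ℝ
  | 0 => fun _ _ => 0
  | c + 1 => fun a x => deriv (upperColumn n u β c a) x
      + (conn n u x).mulVec (fun l => upperColumn n u β c l x) a
      - if (a : ℕ) = 0 then β c x else 0

theorem contDiff_upperColumn {n : ℕ} {u : ℕ → ℝ → ℝ} (hu : ∀ i, ContDiff ℝ ∞ (u i))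
    {β : ℕ → ℝ → ℝ} (hβ : ∀ c, ContDiff ℝ ∞ (β c)) (c : ℕ) (a : Fin n) :
    ContDiff ℝ ∞ (upperColumn n u β c a) := by
  induction c generalizing a with
  | zero => exact contDiff_const
  | succ c ih =>
    refine ContDiff.sub (((contDiff_infty_iff_deriv.1 (ih a)).2).add ?_) ?_
    · simp only [Matrix.mulVec, dotProduct]
      exact ContDiff.sum fun l _ => (matSmooth_conn hu a l).mul (ih l)
    · split_ifs
      · exact hβ c
      · exact contDiff_const

theorem conn_mulVec_apply {n : ℕ} (u : ℕ → ℝ → ℝ) (x : ℝ) (v : Fin n → ℝ) (a : Fin n) :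
    (conn n u x).mulVec v a = (if (a : ℕ) = 0 then 0 else v ⟨a - 1, by have := a.2; omega⟩)
        + if (a : ℕ) + 1 < n then u (a + 1) x * v ⟨n - 1, by have := a.2; omega⟩ else 0 := by
  have h := conn_mul_apply u x (Matrix.of fun l (_ : Fin n) => v l) a a
  simpa [Matrix.mul_apply, Matrix.mulVec, dotProduct] using h

/-- Each application of `b + u` moves the support of a column down by at most one row, provided that
its last entry is zero, so column `c` stays strictly above the diagonal. -/
theorem upperColumn_eq_zero {n : ℕ} (u β : ℕ → ℝ → ℝ) (c : ℕ) (hc : c < n) (a : Fin n)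
    (hac : c ≤ a) : upperColumn n u β c a = 0 := by
  induction c generalizing a with
  | zero => rfl
  | succ c ih =>
    funext x
    have h0 : ¬ (a : ℕ) = 0 := by omega
    simp only [upperColumn, conn_mulVec_apply]
    rw [ih (by omega) a (by omega), ih (by omega) ⟨a - 1, _⟩ (by change c ≤ (a : ℕ) - 1; omega),
      ih (by omega) ⟨n - 1, _⟩ (by change c ≤ n - 1; omega)]
    simp [h0]

theorem trace_bracket {n : ℕ} (u : ℕ → ℝ → ℝ) (C : ℝ → Matrix (Fin n) (Fin n) ℝ) (x : ℝ) :
    (bracket n u C x).trace = (matDeriv C x).trace := by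
  rw [bracket, Matrix.trace_sub, Matrix.trace_add, Matrix.trace_mul_comm, add_sub_cancel_right]

/-- The bracket of `Y_{j,0}` vanishes outside the first row and the last column. The columns of `ζ`
are solved for successively to remove the rest of the first row, and the remaining `(n,n)` entry
vanishes because the bracket is traceless. -/
theorem exists_isZeta {n : ℕ} (hn : 2 ≤ n) {u : ℕ → ℝ → ℝ} (hu : ∀ i, ContDiff ℝ ∞ (u i))
    (j : ℕ) : ∃ ζ, IsZeta n j u ζ := by
  have hn0 : n ≠ 0 := by omega
  have hC := matSmooth_Yj0 hn hu j
  have hbr : ∀ x, bracket n u (Yj0 n j u) x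
      = (Y n u ^ j).coeff 1 x * e1n n - e1n n * (Y n u ^ j).coeff 1 x :=
    (isY_Y hn hu).bracket_pow hn0 hu j
  set β : ℕ → ℝ → ℝ := fun c x =>
    if h : c < n then bracket n u (Yj0 n j u) x ⟨0, by omega⟩ ⟨c, h⟩ else 0 with hβdef
  have hβ : ∀ c, ContDiff ℝ ∞ (β c) := by
    intro c
    simp only [hβdef]
    split_ifs
    · exact matSmooth_bracket hu hC _ _
    · exact contDiff_const
  set ζ : ℝ → Matrix (Fin n) (Fin n) ℝ := fun x => Matrix.of fun a c => upperColumn n u β c a x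
    with hζ
  have hζs : MatSmooth ζ := fun a c => contDiff_upperColumn hu hβ c a
  have hup : ∀ (x : ℝ) (a c : Fin n), c ≤ a → ζ x a c = 0 := fun x a c hca =>
    congrFun (upperColumn_eq_zero u β c c.2 a hca) x
  have hcol : ∀ (x : ℝ) (a c : Fin n), (c : ℕ) + 1 < n →
      bracket n u (fun y => Yj0 n j u y - ζ y) x a c = 0 := by
    intro x a c hc
    rw [bracket_sub u hC hζs, Matrix.sub_apply, bracket_apply_of_lt u ζ x a c hc]
    have h1 : ζ x a ⟨c + 1, hc⟩ = deriv (fun y => ζ y a c) x + (conn n u x * ζ x) a c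
        - if (a : ℕ) = 0 then β c x else 0 := rfl
    rw [h1]
    by_cases ha : (a : ℕ) = 0
    · have h2 : β c x = bracket n u (Yj0 n j u) x a c := by
        rw [show a = ⟨0, by omega⟩ from Fin.ext ha]
        simp only [hβdef, dif_pos c.2]
      rw [if_pos ha, h2]
      ring
    · have h2 : bracket n u (Yj0 n j u) x a c = 0 := by
        rw [hbr, Matrix.sub_apply, e1n_mul_apply, mul_e1n_apply, if_neg ha, if_neg (by omega),
          sub_zero]
      rw [if_neg ha, h2]
      ring
  refine ⟨ζ, hζs, hup, fun x a c hac => ?_⟩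
  by_cases hc : (c : ℕ) + 1 < n
  · exact hcol x a c hc
  · have hcn : (c : ℕ) + 1 = n := by omega
    have hca : a = c := Fin.ext (by omega)
    subst hca
    -- The bracket of `Y_{j,0}` is a commutator, and `ζ` has zero diagonal; both parts have trace
    -- zero.
    have htr : (bracket n u (fun y => Yj0 n j u y - ζ y) x).trace = 0 := by
      rw [bracket_sub u hC hζs, Matrix.trace_sub, hbr, Matrix.trace_sub, Matrix.trace_mul_comm,
        sub_self, zero_sub, neg_eq_zero, trace_bracket]
      refine Finset.sum_eq_zero fun l _ => ?_
      have : (fun y => ζ y l l) = fun _ => 0 := funext fun y => hup y l l le_rfl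
      change deriv (fun y => ζ y l l) x = 0
      rw [this]
      simp
    rw [← htr, Matrix.trace, Finset.sum_eq_single a]
    · rfl
    · intro l _ hl
      have hl' : ¬ (l : ℕ) = a := fun h => hl (Fin.ext h)
      exact hcol x l l (by omega)
    · simp

theorem isZeta_zeta {n : ℕ} (hn : 2 ≤ n) {u : ℕ → ℝ → ℝ} (hu : ∀ i, ContDiff ℝ ∞ (u i))
    (j : ℕ) : IsZeta n j u (zeta n j u) := by
  rw [zeta, dif_pos (exists_isZeta hn hu j)]
  exact (exists_isZeta hn hu j).choose_spec

theorem matSmooth_Zj0 {n : ℕ} (hn : 2 ≤ n) {u : ℕ → ℝ → ℝ} (hu : ∀ i, ContDiff ℝ ∞ (u i))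
    (j : ℕ) : MatSmooth (Zj0 n j u) :=
  (matSmooth_Yj0 hn hu j).sub (isZeta_zeta hn hu j).smooth

theorem inVn_bracket_Zj0 {n : ℕ} (hn : 2 ≤ n) {u : ℕ → ℝ → ℝ} (hu : ∀ i, ContDiff ℝ ∞ (u i))
    (j : ℕ) (x : ℝ) : InVn n (bracket n u (Zj0 n j u) x) :=
  (isZeta_zeta hn hu j).mem x

/-- The first column of `f Z_{j,0}(u) - Z_{j,0}(v) f` is a multiple of `e_1` if `λ e_{1n} + f` is a
gauge transformation from `u` to `v`. -/
theorem gauge_Zj0_apply {n : ℕ} (hn : 2 ≤ n) {u v : ℕ → ℝ → ℝ} (hu : ∀ i, ContDiff ℝ ∞ (u i))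
    (hv : ∀ i, ContDiff ℝ ∞ (v i)) {f : ℝ → Matrix (Fin n) (Fin n) ℝ} (hf : MatSmooth f)
    (hf0 : ∀ (x : ℝ) (a c : Fin n), (c : ℕ) + 1 < a → f x a c = 0)
    (h1 : ∀ x, e1n n * f x + conn n v x * e1n n = f x * e1n n + e1n n * conn n u x)
    (h0 : ∀ x, matDeriv f x = f x * conn n u x - conn n v x * f x) (j : ℕ) (x : ℝ)
    (a c : Fin n) (ha : (a : ℕ) ≠ 0) (hc : (c : ℕ) = 0) :
    (f x * Zj0 n j u x - Zj0 n j v x * f x) a c = 0 := by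
  have hg : f x * Yj0 n j u x - Yj0 n j v x * f x
      = (Y n v ^ j).coeff 1 x * e1n n - e1n n * (Y n u ^ j).coeff 1 x :=
    (isY_Y hn hu).gauge hn hu hv (isY_Y hn hv) hf hf0 h1 h0 j x
  -- The first column of a strictly upper triangular matrix is zero.
  have h2 : (f x * zeta n j u x) a c = 0 := by
    rw [Matrix.mul_apply]
    refine Finset.sum_eq_zero fun l _ => ?_
    rw [(isZeta_zeta hn hu j).upper x l c (by change (c : ℕ) ≤ l; omega), mul_zero]
  -- The first column of `f` lives in the first two rows, and the first two columns of `ζ` are zero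
  -- below the first row.
  have h3 : (zeta n j v x * f x) a c = 0 := by
    rw [Matrix.mul_apply]
    refine Finset.sum_eq_zero fun l _ => ?_
    by_cases hl : (c : ℕ) + 1 < l
    · rw [hf0 x l c hl, mul_zero]
    · rw [(isZeta_zeta hn hv j).upper x a l (by change (l : ℕ) ≤ a; omega), zero_mul]
  have h4 : f x * Zj0 n j u x - Zj0 n j v x * f x
      = (f x * Yj0 n j u x - Yj0 n j v x * f x) - f x * zeta n j u x + zeta n j v x * f x := by
    simp only [Zj0, mul_sub, sub_mul]
    abel
  rw [h4, hg, Matrix.add_apply, Matrix.sub_apply, Matrix.sub_apply, h2, h3, e1n_mul_apply,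
    mul_e1n_apply, if_neg ha, if_neg (by omega)]
  simp

theorem potential_congr {n : ℕ} {u v : ℕ → ℝ → ℝ} (h : ∀ i, 1 ≤ i → i < n → u i = v i) :
    potential n u = potential n v := by
  ext x a c
  simp only [potential, Matrix.of_apply]
  split_ifs with hac
  · rw [h _ (by omega) hac.2]
  · rfl

/-- `Z_{j,0}(u)` depends only on `u_1, …, u_{n-1}`. -/
theorem Zj0_congr {n : ℕ} (j : ℕ) {u v : ℕ → ℝ → ℝ} (h : ∀ i, 1 ≤ i → i < n → u i = v i) :
    Zj0 n j u = Zj0 n j v := by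
  have hp := potential_congr h
  have hl : laxLoop n u = laxLoop n v := by simp only [laxLoop, hp]
  -- Equal predicates have equal chosen witnesses, so neither uniqueness of `Y` nor that of `ζ` is
  -- needed.
  have hY : IsY n u = IsY n v := by
    funext Y
    exact propext ⟨fun H => ⟨H.1, H.2, hl ▸ H.3, H.4, H.5, H.6⟩,
      fun H => ⟨H.1, H.2, hl ▸ H.3, H.4, H.5, H.6⟩⟩
  have hYY : Y n u = Y n v := by
    unfold Y
    generalize IsY n u = P at hY
    subst hY
    rfl
  have hY0 : Yj0 n j u = Yj0 n j v := by simp only [Yj0, hYY]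
  have hb : bracket n u = bracket n v := by
    funext C x
    simp only [bracket, hp]
  have hζ : IsZeta n j u = IsZeta n j v := by
    funext ζ
    refine propext ⟨fun H => ⟨H.1, H.2, fun x => ?_⟩, fun H => ⟨H.1, H.2, fun x => ?_⟩⟩
    · rw [← hb, ← hY0]; exact H.3 x
    · rw [hb, hY0]; exact H.3 x
  have hζζ : zeta n j u = zeta n j v := by
    unfold zeta
    generalize IsZeta n j u = P at hζ
    subst hζ
    rfl
  funext x
  simp only [Zj0, hY0, hζζ]

/-! ### The matrix `f_{u,h}` and its `x`-derivative. -/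

theorem contDiff_iteratedDeriv {h : ℝ → ℝ} (hh : ContDiff ℝ ∞ h) (k : ℕ) :
    ContDiff ℝ ∞ (iteratedDeriv k h) := by
  induction k with
  | zero => simpa using hh
  | succ k ih =>
    rw [iteratedDeriv_succ]
    exact (contDiff_infty_iff_deriv.1 ih).2

theorem hasDerivAt_iteratedDeriv {h : ℝ → ℝ} (hh : ContDiff ℝ ∞ h) (k : ℕ) (x : ℝ) :
    HasDerivAt (iteratedDeriv k h) (iteratedDeriv (k + 1) h x) x := by
  rw [iteratedDeriv_succ]
  exact ((contDiff_iteratedDeriv hh k).differentiable (by simp) x).hasDerivAt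

theorem contDiff_newPotentialAux (n : ℕ) {u : ℕ → ℝ → ℝ} (hu : ∀ i, ContDiff ℝ ∞ (u i))
    {h : ℝ → ℝ} (hh : ContDiff ℝ ∞ h) (q : ℕ) : ContDiff ℝ ∞ (newPotentialAux n u h q) := by
  induction q with
  | zero => exact contDiff_const
  | succ q ih =>
    have hd : ∀ k, ContDiff ℝ ∞ (iteratedDeriv k h) := contDiff_iteratedDeriv hh
    refine ContDiff.sub (ContDiff.sub (ContDiff.sub (ContDiff.add (hu _) ?_) (hh.mul ih)) ?_)
      (contDiff_const.mul (hd _))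
    · exact ContDiff.sum fun m _ => (contDiff_const.mul (hd _)).mul (hu m)
    · exact (contDiff_infty_iff_deriv.1 (ih.add (contDiff_const.mul (hd q)))).2

theorem contDiff_newPotential (n : ℕ) {u : ℕ → ℝ → ℝ} (hu : ∀ i, ContDiff ℝ ∞ (u i))
    {h : ℝ → ℝ} (hh : ContDiff ℝ ∞ h) (i : ℕ) : ContDiff ℝ ∞ (newPotential n u h i) :=
  contDiff_newPotentialAux n hu hh _

/-- The diagonal fits the formula for the upper triangle because `ũ_n = 0`. -/
theorem darboux_zero_apply_of_le {n : ℕ} (u : ℕ → ℝ → ℝ) (h : ℝ → ℝ) (x : ℝ) (a c : Fin n)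
    (hac : (a : ℕ) ≤ c) : darboux n u h x 0 a c =
      (if (c : ℕ) + 1 = n then newPotential n u h (a + 1) x else 0)
        + ((c : ℕ).choose a : ℝ) * iteratedDeriv (c - a) h x := by
  have h1 : ¬ (a : ℕ) = c + 1 := by omega
  rcases Nat.lt_or_eq_of_le hac with h2 | h2
  · have h3 : a ≠ c := fun h => by rw [h] at h2; omega
    simp [darboux, shift, Nmat, h1, h3, -Fin.val_fin_lt, h2]
  · have h3 : a = c := Fin.ext h2
    subst h3
    have h4 : (if (a : ℕ) + 1 = n then newPotential n u h (a + 1) x else 0) = 0 := by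
      split_ifs with h5
      · rw [newPotential, h5, Nat.sub_self]; rfl
      · rfl
    rw [h4]
    simp [darboux, shift, Nmat]

theorem darboux_zero_apply_succ {n : ℕ} (u : ℕ → ℝ → ℝ) (h : ℝ → ℝ) (x : ℝ) (a c : Fin n)
    (hac : (a : ℕ) = c + 1) : darboux n u h x 0 a c = 1 := by
  have h3 : a ≠ c := fun h => by rw [h] at hac; omega
  simp [darboux, shift, Nmat, h3, -Fin.val_fin_lt, hac]

theorem darboux_zero_apply_of_gt {n : ℕ} (u : ℕ → ℝ → ℝ) (h : ℝ → ℝ) (x : ℝ) (a c : Fin n)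
    (hac : (c : ℕ) + 1 < a) : darboux n u h x 0 a c = 0 := by
  have h3 : a ≠ c := fun h => by rw [h] at hac; omega
  have h2 : ¬ (a : ℕ) < c := by omega
  have h1 : ¬ (a : ℕ) = c + 1 := by omega
  simp [darboux, shift, Nmat, h3, -Fin.val_fin_lt, h2, h1]

theorem darboux_zero_last {n : ℕ} (u : ℕ → ℝ → ℝ) (h : ℝ → ℝ) (x : ℝ) (a : Fin n) :
    darboux n u h x 0 a a = h x := by
  have h4 : (if (a : ℕ) + 1 = n then newPotential n u h (a + 1) x else 0) = 0 := by
    split_ifs with h5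
    · rw [newPotential, h5, Nat.sub_self]; rfl
    · rfl
  rw [darboux_zero_apply_of_le _ _ _ _ _ le_rfl, h4]
  simp

theorem matSmooth_darboux {n : ℕ} {u : ℕ → ℝ → ℝ} (hu : ∀ i, ContDiff ℝ ∞ (u i))
    {h : ℝ → ℝ} (hh : ContDiff ℝ ∞ h) : MatSmooth fun x => darboux n u h x 0 := by
  intro a c
  rcases lt_trichotomy (c : ℕ) a with hac | hac | hac
  · rcases Nat.lt_or_eq_of_le hac with h2 | h2
    · simp only [darboux_zero_apply_of_gt u h _ a c h2]
      exact contDiff_const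
    · simp only [darboux_zero_apply_succ u h _ a c h2.symm]
      exact contDiff_const
  · have : a = c := Fin.ext hac.symm
    subst this
    simp only [darboux_zero_last]
    exact hh
  · simp only [darboux_zero_apply_of_le u h _ a c hac.le]
    refine ContDiff.add ?_ (contDiff_const.mul (contDiff_iteratedDeriv hh _))
    split_ifs
    · exact contDiff_newPotential n hu hh _
    · exact contDiff_const

theorem conn_apply_last {n : ℕ} (u : ℕ → ℝ → ℝ) (x : ℝ) (a c : Fin n) (hc : (c : ℕ) + 1 = n) :
    conn n u x a c = if (a : ℕ) + 1 < n then u (a + 1) x else 0 := by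
  have := a.2
  simp [conn, shift, potential, hc, show ¬ (a : ℕ) = n by omega]

/-- The defining property of `ũ`. -/
theorem matDeriv_darboux_apply {n : ℕ} (hn : 2 ≤ n) (u : ℕ → ℝ → ℝ) {h : ℝ → ℝ} (hh : ContDiff ℝ ∞ h) (x : ℝ) (a c : Fin n)
    (hac : ¬ ((a : ℕ) = 0 ∧ (c : ℕ) + 1 = n)) :
    matDeriv (fun y => darboux n u h y 0) x a c =
      (darboux n u h x 0 * conn n u x) a c
        - (conn n (newPotential n u h) x * darboux n u h x 0) a c := by
  have hderiv : ∀ (c a : ℕ), deriv (fun y => (c.choose a : ℝ) * iteratedDeriv (c - a) h y) x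
      = (c.choose a : ℝ) * iteratedDeriv (c - a + 1) h x := fun c a =>
    ((hasDerivAt_iteratedDeriv hh _ x).const_mul _).deriv
  change deriv (fun y => darboux n u h y 0 a c) x = _
  by_cases hc : (c : ℕ) + 1 < n
  · rw [mul_conn_apply_of_lt u x _ a c hc, conn_mul_apply]
    rcases lt_or_ge (c : ℕ) a with hca | hca
    · have ha0 : ¬ (a : ℕ) = 0 := by omega
      have hlast : (if (a : ℕ) + 1 < n then newPotential n u h (a + 1) x
          * darboux n u h x 0 ⟨n - 1, by omega⟩ c else 0) = 0 := by
        split_ifs with h1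
        · rw [darboux_zero_apply_of_gt _ _ _ _ _ (by change (c : ℕ) + 1 < n - 1; omega), mul_zero]
        · rfl
      rw [hlast, if_neg ha0, add_zero]
      by_cases h1 : (a : ℕ) = c + 1
      · have h2 : a = ⟨c + 1, hc⟩ := Fin.ext h1
        have h3 : (⟨a - 1, by omega⟩ : Fin n) = c := Fin.ext (by simp [h1])
        simp only [darboux_zero_apply_succ u h _ a c h1]
        rw [h3, ← h2, darboux_zero_last, darboux_zero_last]
        simp
      · simp only [darboux_zero_apply_of_gt u h _ a c (by omega)]
        by_cases h2 : (a : ℕ) = c + 2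
        · rw [darboux_zero_apply_succ _ _ _ _ _ (by simp [h2]),
            darboux_zero_apply_succ _ _ _ _ _ (by simp [h2])]
          simp
        · rw [darboux_zero_apply_of_gt _ _ _ _ _ (by change (c : ℕ) + 1 + 1 < a; omega),
            darboux_zero_apply_of_gt _ _ _ _ _ (by change (c : ℕ) + 1 < a - 1; omega)]
          simp
    · have hlast : darboux n u h x 0 ⟨n - 1, by omega⟩ c = if (c : ℕ) + 1 + 1 = n then 1 else 0 := by
        split_ifs with h1
        · rw [darboux_zero_apply_succ _ _ _ _ _ (by change n - 1 = (c : ℕ) + 1; omega)]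
        · rw [darboux_zero_apply_of_gt _ _ _ _ _ (by change (c : ℕ) + 1 < n - 1; omega)]
      simp only [darboux_zero_apply_of_le u h _ a c hca, if_neg (show ¬ (c : ℕ) + 1 = n by omega),
        zero_add]
      rw [hlast, hderiv, if_pos (show (a : ℕ) + 1 < n by omega),
        darboux_zero_apply_of_le _ _ _ _ _ (by change (a : ℕ) ≤ c + 1; omega)]
      have hd : (c : ℕ) + 1 - a = c - a + 1 := by omega
      by_cases ha0 : (a : ℕ) = 0
      · simp [ha0]
      · rw [if_neg ha0, darboux_zero_apply_of_le _ _ _ _ _ (by change (a : ℕ) - 1 ≤ c; omega),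
          if_neg (show ¬ (c : ℕ) + 1 = n by omega)]
        have hd2 : (c : ℕ) - (a - 1) = c - a + 1 := by omega
        -- Pascal's rule is exactly what makes the binomial entries of `N` satisfy the equation in
        -- the columns before the last.
        have hp : ((c : ℕ) + 1).choose a = (c : ℕ).choose (a - 1) + (c : ℕ).choose a := by
          obtain ⟨b, hb⟩ := Nat.exists_eq_succ_of_ne_zero ha0
          rw [hb]
          simp [Nat.choose_succ_succ]
        simp only [hd, hd2, hp]
        push_cast
        split_ifs <;> ring
  · have hcn : (c : ℕ) + 1 = n := by have := c.2; omega
    have ha0 : ¬ (a : ℕ) = 0 := fun h0 => hac ⟨h0, hcn⟩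
    have hale : (a : ℕ) ≤ c := by have := a.2; omega
    have hcl : (⟨n - 1, by omega⟩ : Fin n) = c := Fin.ext (by change n - 1 = (c : ℕ); omega)
    rw [conn_mul_apply, if_neg ha0, hcl, darboux_zero_last,
      darboux_zero_apply_of_le _ _ _ _ _ (by change (a : ℕ) - 1 ≤ c; omega), if_pos hcn]
    simp only [darboux_zero_apply_of_le u h _ a c hale, if_pos hcn]
    have hprod : (darboux n u h x 0 * conn n u x) a c = u a x
        + ∑ m ∈ Finset.Icc (a + 1 : ℕ) (n - 1),
          ((m - 1).choose a : ℝ) * iteratedDeriv (m - (a + 1)) h x * u m x := by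
      set F : ℕ → ℝ := fun l => if l + 1 < n then ((if (a : ℕ) = l + 1 then 1 else 0)
        + if (a : ℕ) ≤ l then (l.choose a : ℝ) * iteratedDeriv (l - a) h x else 0) * u (l + 1) x
        else 0 with hF
      have h1 : (darboux n u h x 0 * conn n u x) a c = ∑ l : Fin n, F l := by
        rw [Matrix.mul_apply]
        refine Finset.sum_congr rfl fun l _ => ?_
        rw [conn_apply_last u x l c hcn]
        simp only [hF]
        split_ifs with h1 h2 h3 h3
        · omega
        · rw [darboux_zero_apply_succ _ _ _ _ _ h2]; simp
        · rw [darboux_zero_apply_of_le _ _ _ _ _ h3, if_neg (by omega), zero_add]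
        · rw [darboux_zero_apply_of_gt _ _ _ _ _ (by omega)]; simp
        · simp
      rw [h1, Fin.sum_univ_eq_sum_range F n]
      -- Row `a` of `f` vanishes to the left of the subdiagonal position `a - 1`, and the last row
      -- of the potential is zero.
      have h2 : ∑ l ∈ Finset.range n, F l = ∑ l ∈ insert ((a : ℕ) - 1) (Finset.Ico (a : ℕ) (n - 1)),
          F l := by
        symm
        refine Finset.sum_subset ?_ ?_
        · intro l hl
          simp only [Finset.mem_insert, Finset.mem_Ico, Finset.mem_range] at hl ⊢
          have := a.2
          omega
        · intro l hl hl2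
          simp only [Finset.mem_insert, Finset.mem_Ico, Finset.mem_range] at hl hl2
          simp only [hF]
          by_cases h3 : l + 1 < n
          · rw [if_pos h3, if_neg (by omega), if_neg (by omega)]
            simp
          · rw [if_neg h3]
      rw [h2, Finset.sum_insert (by simp; omega)]
      have h3 : F ((a : ℕ) - 1) = u a x := by
        have h4 : (a : ℕ) - 1 + 1 = a := by omega
        simp only [hF, h4]
        rw [if_pos a.2]
        simp [show ¬ (a : ℕ) ≤ a - 1 by omega]
      have h5 : ∑ l ∈ Finset.Ico (a : ℕ) (n - 1), F l = ∑ m ∈ Finset.Icc (a + 1 : ℕ) (n - 1),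
          ((m - 1).choose a : ℝ) * iteratedDeriv (m - (a + 1)) h x * u m x := by
        refine Finset.sum_nbij' (· + 1) (· - 1) ?_ ?_ ?_ ?_ ?_
        · intro l hl
          simp only [Finset.mem_Ico, Finset.mem_Icc] at hl ⊢
          omega
        · intro l hl
          simp only [Finset.mem_Ico, Finset.mem_Icc] at hl ⊢
          omega
        · intro l hl
          simp
        · intro l hl
          simp only [Finset.mem_Icc] at hl
          omega
        · intro l hl
          simp only [Finset.mem_Ico] at hl
          simp only [hF]
          rw [if_pos (by omega), if_neg (by omega), if_pos hl.1, zero_add, Nat.add_sub_cancel,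
            Nat.add_sub_add_right]
      rw [h3, h5]
    rw [hprod]
    have hq : n - (a : ℕ) = n - 1 - a + 1 := by have := a.2; omega
    -- Row `a`, counted from zero, is the classical row `p = a + 1`. The recursion at `q = n - 1 -
    -- a` solves this row for `ũ_{p-1} = ũ_a`.
    have hpot : newPotential n u h a x = newPotentialAux n u h (n - 1 - a + 1) x := by
      rw [newPotential, hq]
    have hcm : (a : ℕ) - 1 + 1 = a := by omega
    have e1 : n - (n - 1 - (a : ℕ)) = a + 1 := by have := a.2; omega
    have e2 : n - (n - 1 - (a : ℕ)) - 1 = a := by omega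
    have e3 : n - (n - 1 - (a : ℕ)) - 2 = a - 1 := by omega
    have e4 : n - 1 - (a : ℕ) = n - (a + 1) := by omega
    have e5 : (c : ℕ) = n - 1 := by omega
    have e6 : n - 1 - ((a : ℕ) - 1) = n - (a + 1) + 1 := by have := a.2; omega
    have hlast : (if (a : ℕ) + 1 < n then newPotential n u h (a + 1) x * h x else 0)
        = newPotential n u h (a + 1) x * h x := by
      split_ifs with h1
      · rfl
      · rw [newPotential, show n - ((a : ℕ) + 1) = 0 by omega]
        simp [newPotentialAux]
    rw [newPotentialAux, e2, e3, e1, e4] at hpot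
    rw [hcm, hlast, hpot, e5, e6, show n - 1 - (a : ℕ) = n - (a + 1) by omega]
    simp only [newPotential]
    ring

/-- The terms of degree one in `λ` of `f_x = f (J + u) - (J + ũ) f`. -/
theorem e1n_darboux {n : ℕ} (hn : 2 ≤ n) (u : ℕ → ℝ → ℝ) (h : ℝ → ℝ) (v : ℕ → ℝ → ℝ) (x : ℝ) :
    e1n n * darboux n u h x 0 + conn n v x * e1n n
      = darboux n u h x 0 * e1n n + e1n n * conn n u x := by
  ext a c
  simp only [Matrix.add_apply, e1n_mul_apply, mul_e1n_apply]
  have hv0 : ∀ a : Fin n, conn n v x a ⟨0, by omega⟩ = if (a : ℕ) = 1 then 1 else 0 := fun a => by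
    simp [conn, shift, potential, show ¬ 1 = n by omega]
  have hu1 : conn n u x ⟨n - 1, by omega⟩ c = if n - 1 = (c : ℕ) + 1 then 1 else 0 := by
    simp [conn, shift, potential, show ¬ n - 1 + 1 < n by omega]
  rw [hv0, hu1]
  by_cases ha : (a : ℕ) = 0
  · have ha' : a = ⟨0, by omega⟩ := Fin.ext ha
    by_cases hc : (c : ℕ) + 1 = n
    · have hc' : (⟨n - 1, by omega⟩ : Fin n) = c := Fin.ext (by change n - 1 = (c : ℕ); omega)
      rw [hc', ← ha', darboux_zero_last, darboux_zero_last]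
      simp [ha, hc, show ¬ n - 1 = n by omega]
    · have hcn := c.2
      simp only [ha, hc, if_true, if_false, add_zero, zero_add]
      split_ifs with h1
      · exact darboux_zero_apply_succ _ _ _ _ _ h1
      · exact darboux_zero_apply_of_gt _ _ _ _ _ (by change (c : ℕ) + 1 < n - 1; omega)
  · simp only [ha, if_false, add_zero, zero_add]
    split_ifs with _ h2
    · exact (darboux_zero_apply_succ _ _ _ _ _ h2).symm
    · exact (darboux_zero_apply_of_gt _ _ _ _ _ (by change 0 + 1 < (a : ℕ); omega)).symm
    · rfl

/-- Jacobi's formula: differentiating one column at a time gives determinants that Cramer's rule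
identifies with the diagonal entries of `adjugate * A'`. -/
theorem hasDerivAt_det {n : ℕ} {A : ℝ → Matrix (Fin n) (Fin n) ℝ} {A' : Matrix (Fin n) (Fin n) ℝ}
    {x : ℝ} (hA : ∀ a c, HasDerivAt (fun y => A y a c) (A' a c) x) :
    HasDerivAt (fun y => (A y).det) ((A x).adjugate * A').trace x := by
  have h1 : ((A x).adjugate * A').trace
      = ∑ i, ((A x).updateCol i (fun a => A' a i)).det := by
    refine Finset.sum_congr rfl fun i _ => ?_
    rw [← Matrix.cramer_apply, Matrix.cramer_eq_adjugate_mulVec]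
    rfl
  have h2 : ∑ i, ((A x).updateCol i (fun a => A' a i)).det
      = ∑ σ : Equiv.Perm (Fin n), ((Equiv.Perm.sign σ : ℤ) : ℝ) *
        ∑ i, (∏ l ∈ Finset.univ.erase i, A x (σ l) l) • A' (σ i) i := by
    simp only [Matrix.det_apply']
    rw [Finset.sum_comm]
    refine Finset.sum_congr rfl fun σ _ => ?_
    rw [Finset.mul_sum]
    refine Finset.sum_congr rfl fun i _ => ?_
    rw [← Finset.mul_prod_erase _ _ (Finset.mem_univ i), Matrix.updateCol_self, smul_eq_mul,
      mul_comm (A' (σ i) i)]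
    congr 2
    refine Finset.prod_congr rfl fun l hl => ?_
    rw [Matrix.updateCol_ne (Finset.ne_of_mem_erase hl)]
  rw [h1, h2]
  simp only [Matrix.det_apply']
  exact HasDerivAt.fun_sum fun σ _ => HasDerivAt.const_mul _
    (HasDerivAt.fun_finsetProd fun l _ => hA (σ l) l)

theorem trace_conn {n : ℕ} (u : ℕ → ℝ → ℝ) (x : ℝ) : (conn n u x).trace = 0 := by
  refine Finset.sum_eq_zero fun a _ => ?_
  simp [conn, shift, potential]
  omega

/-- Both sides are the `λ`-derivative of `det f` at `λ = 0`: one by Jacobi's formula, the other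
because `det f` is affine in `λ`. -/
theorem trace_adjugate_mul_e1n {n : ℕ} (hn : 1 ≤ n) (u : ℕ → ℝ → ℝ) (h : ℝ → ℝ) (x : ℝ) :
    ((darboux n u h x 0).adjugate * e1n n).trace = (-1) ^ (n - 1) := by
  have h1 : HasDerivAt (fun l => (darboux n u h x l).det)
      ((darboux n u h x 0).adjugate * e1n n).trace 0 := by
    refine hasDerivAt_det fun a c => ?_
    simp only [darboux, Matrix.add_apply, Matrix.smul_apply, smul_eq_mul]
    have := (((hasDerivAt_id (0 : ℝ)).mul_const (e1n n a c)).add_const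
      (shift n a c)).add_const (h x * (1 : Matrix (Fin n) (Fin n) ℝ) a c)
    simpa using this.add_const (Nmat n u h x a c)
  have h2 : HasDerivAt (fun l => (darboux n u h x l).det) ((-1) ^ (n - 1)) 0 := by
    simp only [det_darboux hn]
    have := (((hasDerivAt_id (0 : ℝ)).add_const (iteratedDeriv (n - 1) h x)).sub_const
      (xi n u h x)).const_mul ((-1 : ℝ) ^ (n - 1))
    simpa using this
  exact h1.unique h2

/-- If `det f` is constant, then `f_x = f (b + u) - (b + ũ) f` at `λ = 0`. -/
theorem matDeriv_darboux {n : ℕ} (hn : 2 ≤ n) {u : ℕ → ℝ → ℝ}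
    (hu : ∀ i, ContDiff ℝ ∞ (u i)) {h : ℝ → ℝ} (hh : ContDiff ℝ ∞ h) {k : ℝ}
    (hdet : ∀ x, (darboux n u h x 0).det = k) (x : ℝ) :
    matDeriv (fun y => darboux n u h y 0) x =
      darboux n u h x 0 * conn n u x - conn n (newPotential n u h) x * darboux n u h x 0 := by
  set f := darboux n u h x 0 with hf
  -- `e` is the defect in the one entry not covered by the definition of `ũ`. As `b + u` and `b + ũ`
  -- are traceless, Jacobi's formula for the constant determinant reduces to `e (-1)^(n-1) = 0`.
  set e := matDeriv (fun y => darboux n u h y 0) x ⟨0, by omega⟩ ⟨n - 1, by omega⟩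
    - (f * conn n u x - conn n (newPotential n u h) x * f) ⟨0, by omega⟩ ⟨n - 1, by omega⟩ with he
  have h1 : matDeriv (fun y => darboux n u h y 0) x =
      f * conn n u x - conn n (newPotential n u h) x * f + e • e1n n := by
    ext a c
    rw [Matrix.add_apply, Matrix.smul_apply]
    by_cases hac : (a : ℕ) = 0 ∧ (c : ℕ) + 1 = n
    · have ha : a = ⟨0, by omega⟩ := Fin.ext hac.1
      have hc : c = ⟨n - 1, by omega⟩ := Fin.ext (by change (c : ℕ) = n - 1; omega)
      have h2 : e1n n a c = 1 := by simp [e1n, hac]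
      rw [h2, he, ← ha, ← hc]
      simp
    · have h2 : e1n n a c = 0 := by
        simp only [e1n, Matrix.of_apply, if_neg hac]
      rw [matDeriv_darboux_apply hn u hh x a c hac, h2, Matrix.sub_apply]
      simp [hf]
  have h2 := hasDerivAt_det (A := fun y => darboux n u h y 0) (x := x)
    (A' := matDeriv (fun y => darboux n u h y 0) x) fun a c =>
      ((matSmooth_darboux hu hh).differentiableAt a c x).hasDerivAt
  simp only [hdet] at h2
  have h3 := h2.unique (hasDerivAt_const x k)
  rw [← hf, h1, mul_add, mul_sub, Matrix.trace_add, Matrix.trace_sub, ← mul_assoc,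
    Matrix.adjugate_mul, Matrix.trace_mul_comm f.adjugate, mul_assoc, Matrix.mul_adjugate] at h3
  simp only [smul_mul_assoc, one_mul, mul_smul_comm, mul_one, Matrix.trace_smul, trace_conn,
    hf, trace_adjugate_mul_e1n (show 1 ≤ n by omega), smul_zero, sub_zero, zero_add] at h3
  have h4 : e = 0 := by
    rcases smul_eq_zero.1 h3 with h4 | h4
    · exact h4
    · exact absurd h4 (pow_ne_zero _ (by norm_num))
  rw [h1, h4]
  simp

/-! ### Functions of two variables -/

/-- Joint smoothness of a function of `x` and `t`. -/
def Smooth₂ (F : ℝ → ℝ → ℝ) : Prop := ContDiff ℝ ∞ (fun p : ℝ × ℝ => F p.1 p.2)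

/-- Entrywise joint smoothness of a matrix-valued function of `x` and `t`. -/
def MatSmooth₂ {n : ℕ} (A : ℝ → ℝ → Matrix (Fin n) (Fin n) ℝ) : Prop :=
  ∀ a c : Fin n, Smooth₂ fun x t => A x t a c

namespace Smooth₂

variable {F : ℝ → ℝ → ℝ} (hF : Smooth₂ F)
include hF

theorem fst (t : ℝ) : ContDiff ℝ ∞ fun x => F x t :=
  ContDiff.comp (g := fun p : ℝ × ℝ => F p.1 p.2) hF (contDiff_id.prodMk contDiff_const)

theorem snd (x : ℝ) : ContDiff ℝ ∞ fun t => F x t :=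
  ContDiff.comp (g := fun p : ℝ × ℝ => F p.1 p.2) hF (contDiff_const.prodMk contDiff_id)

theorem hasFDerivAt (p : ℝ × ℝ) : HasFDerivAt (fun p : ℝ × ℝ => F p.1 p.2)
    (fderiv ℝ (fun p : ℝ × ℝ => F p.1 p.2) p) p :=
  (ContDiff.differentiable hF (by simp) p).hasFDerivAt

theorem deriv_fst_eq (x t : ℝ) : deriv (fun y => F y t) x
    = fderiv ℝ (fun p : ℝ × ℝ => F p.1 p.2) (x, t) (1, 0) := by
  have h : HasDerivAt (fun y : ℝ => ((y, t) : ℝ × ℝ)) (1, 0) x :=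
    (hasDerivAt_id x).prodMk (hasDerivAt_const x t)
  exact ((hF.hasFDerivAt (x, t)).comp_hasDerivAt x h).deriv

theorem deriv_snd_eq (x t : ℝ) : deriv (fun s => F x s) t
    = fderiv ℝ (fun p : ℝ × ℝ => F p.1 p.2) (x, t) (0, 1) := by
  have h : HasDerivAt (fun s : ℝ => ((x, s) : ℝ × ℝ)) (0, 1) t :=
    (hasDerivAt_const t x).prodMk (hasDerivAt_id t)
  exact ((hF.hasFDerivAt (x, t)).comp_hasDerivAt t h).deriv

theorem contDiff_fderiv : ContDiff ℝ ∞ (fderiv ℝ (fun p : ℝ × ℝ => F p.1 p.2)) :=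
  ContDiff.fderiv_right hF (by simp)

theorem deriv_fst : Smooth₂ fun x t => deriv (fun y => F y t) x := by
  simp only [hF.deriv_fst_eq]
  exact hF.contDiff_fderiv.clm_apply contDiff_const

theorem deriv_snd : Smooth₂ fun x t => deriv (fun s => F x s) t := by
  simp only [hF.deriv_snd_eq]
  exact hF.contDiff_fderiv.clm_apply contDiff_const

theorem deriv_comm (x t : ℝ) : deriv (fun s => deriv (fun y => F y s) x) t
    = deriv (fun y => deriv (fun s => F y s) t) x := by
  rw [hF.deriv_fst.deriv_snd_eq, hF.deriv_snd.deriv_fst_eq]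
  simp only [hF.deriv_fst_eq, hF.deriv_snd_eq]
  have hd : DifferentiableAt ℝ (fderiv ℝ (fun p : ℝ × ℝ => F p.1 p.2)) (x, t) :=
    hF.contDiff_fderiv.differentiable (by simp) _
  have h1 : ∀ v : ℝ × ℝ,
      fderiv ℝ (fun p : ℝ × ℝ => fderiv ℝ (fun p : ℝ × ℝ => F p.1 p.2) (p.1, p.2) v) (x, t)
      = (fderiv ℝ (fderiv ℝ (fun p : ℝ × ℝ => F p.1 p.2)) (x, t)).flip v := by
    intro v
    exact (hd.hasFDerivAt.clm_apply (hasFDerivAt_const v _)).fderiv.trans (by ext <;> simp)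
  rw [h1, h1]
  simp only [ContinuousLinearMap.flip_apply]
  exact ((ContDiff.contDiffAt hF).isSymmSndFDerivAt (by
    rw [minSmoothness_of_isRCLikeNormedField]
    exact WithTop.coe_le_coe.2 (le_top : (2 : ℕ∞) ≤ ⊤))).eq _ _

theorem iteratedDeriv_fst (k : ℕ) : Smooth₂ fun x t => iteratedDeriv k (fun y => F y t) x := by
  induction k with
  | zero => simpa using hF
  | succ k ih =>
    simp only [iteratedDeriv_succ]
    exact ih.deriv_fst

end Smooth₂

theorem contDiff_det {E : Type*} [NormedAddCommGroup E] [NormedSpace ℝ E] {n : ℕ}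
    {A : E → Matrix (Fin n) (Fin n) ℝ} (hA : ∀ a c, ContDiff ℝ ∞ fun p => A p a c) :
    ContDiff ℝ ∞ fun p => (A p).det := by
  simp only [Matrix.det_apply']
  exact ContDiff.sum fun σ _ => contDiff_const.mul (contDiff_prod fun l _ => hA _ _)

theorem contDiff_adjugate {E : Type*} [NormedAddCommGroup E] [NormedSpace ℝ E] {n : ℕ}
    {A : E → Matrix (Fin n) (Fin n) ℝ} (hA : ∀ a c, ContDiff ℝ ∞ fun p => A p a c) (a c : Fin n) :
    ContDiff ℝ ∞ fun p => (A p).adjugate a c := by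
  simp only [Matrix.adjugate_apply]
  refine contDiff_det fun l m => ?_
  simp only [Matrix.updateRow_apply]
  split_ifs
  · exact contDiff_const
  · exact hA l m

namespace MatSmooth₂

variable {n : ℕ} {A B : ℝ → ℝ → Matrix (Fin n) (Fin n) ℝ}

theorem fst (hA : MatSmooth₂ A) (t : ℝ) : MatSmooth fun x => A x t := fun a c => (hA a c).fst t

theorem snd (hA : MatSmooth₂ A) (x : ℝ) : MatSmooth fun t => A x t := fun a c => (hA a c).snd x

theorem mul (hA : MatSmooth₂ A) (hB : MatSmooth₂ B) : MatSmooth₂ fun x t => A x t * B x t := by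
  intro a c
  simp only [Matrix.mul_apply]
  exact ContDiff.sum fun l _ => ContDiff.mul (hA a l) (hB l c)

theorem deriv_snd (hA : MatSmooth₂ A) : MatSmooth₂ fun x t => matDeriv (fun s => A x s) t :=
  fun a c => (hA a c).deriv_snd

theorem matDeriv_comm (hA : MatSmooth₂ A) (x t : ℝ) :
    matDeriv (fun s => matDeriv (fun y => A y s) x) t
      = matDeriv (fun y => matDeriv (fun s => A y s) t) x := by
  ext a c
  exact (hA a c).deriv_comm x t

end MatSmooth₂

theorem matDeriv_mul {n : ℕ} {A B : ℝ → Matrix (Fin n) (Fin n) ℝ} (hA : MatSmooth A)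
    (hB : MatSmooth B) (x : ℝ) :
    matDeriv (fun y => A y * B y) x = matDeriv A x * B x + A x * matDeriv B x := by
  ext a c
  simp only [Matrix.add_apply, Matrix.mul_apply, matDeriv, Matrix.of_apply,
    ← Finset.sum_add_distrib]
  exact (HasDerivAt.fun_sum fun l _ => (hA.differentiableAt a l x).hasDerivAt.mul
    (hB.differentiableAt l c x).hasDerivAt).deriv

theorem matDeriv_sub {n : ℕ} {A B : ℝ → Matrix (Fin n) (Fin n) ℝ} (hA : MatSmooth A)
    (hB : MatSmooth B) (x : ℝ) :
    matDeriv (fun y => A y - B y) x = matDeriv A x - matDeriv B x := by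
  ext a c
  exact deriv_fun_sub (hA.differentiableAt a c x) (hB.differentiableAt a c x)

/-! ### Central affine curves -/

theorem mul_conn_apply_last {n : ℕ} (u : ℕ → ℝ → ℝ) (x : ℝ) (M : Matrix (Fin n) (Fin n) ℝ)
    (a c : Fin n) (hc : (c : ℕ) + 1 = n) : (M * conn n u x) a c
      = ∑ l : Fin n, M a l * if (l : ℕ) + 1 < n then u (l + 1) x else 0 := by
  rw [Matrix.mul_apply]
  exact Finset.sum_congr rfl fun l _ => by rw [conn_apply_last u x l c hc]

theorem frame_apply {n : ℕ} (c : ℝ → Fin n → ℝ) (x : ℝ) (a k : Fin n) :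
    frame c x a k = iteratedDeriv k (fun y => c y a) x := rfl

theorem matDeriv_frame_apply {n : ℕ} (c : ℝ → Fin n → ℝ) (x : ℝ) (a k : Fin n) :
    matDeriv (frame c) x a k = iteratedDeriv (k + 1) (fun y => c y a) x := by
  rw [iteratedDeriv_succ]
  rfl

theorem matSmooth_frame {n : ℕ} {c : ℝ → Fin n → ℝ} (hc : ∀ a, ContDiff ℝ ∞ fun y => c y a) :
    MatSmooth (frame c) :=
  fun a k => contDiff_iteratedDeriv (hc a) k

/-- The moving frame equation `g_x = g (b + u)`. -/
theorem matDeriv_frame {n : ℕ} (hn : 1 ≤ n) {c : ℝ → Fin n → ℝ}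
    (hc : ∀ a, ContDiff ℝ ∞ fun y => c y a) (hdet : ∀ x, (frame c x).det = 1) (x : ℝ) :
    matDeriv (frame c) x = frame c x * conn n (curvature c) x := by
  set g := frame c x with hg
  set v : Fin n → ℝ := fun a => iteratedDeriv n (fun y => c y a) x with hv
  have hcurv : ∀ l : Fin n, (g.adjugate.mulVec v) l = curvature c (l + 1) x := by
    intro l
    rw [← Matrix.cramer_eq_adjugate_mulVec, Matrix.cramer_apply, curvature]
    congr 1
    ext a k
    simp only [Matrix.updateCol_apply, Matrix.of_apply, hg, hv, frame_apply]
    by_cases hkl : k = l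
    · simp [hkl]
    · have : ¬ (k : ℕ) = l := fun h => hkl (Fin.ext h)
      simp [hkl, this]
  have hv2 : ∀ a, v a = ∑ l : Fin n, g a l * curvature c (l + 1) x := by
    intro a
    have : g.mulVec (g.adjugate.mulVec v) = v := by
      rw [Matrix.mulVec_mulVec, Matrix.mul_adjugate, hdet, one_smul, Matrix.one_mulVec]
    rw [← congrFun this a, Matrix.mulVec, dotProduct]
    exact Finset.sum_congr rfl fun l _ => by rw [hcurv]
  set q : Fin n := ⟨n - 1, by omega⟩ with hq
  have hq1 : (q : ℕ) + 1 = n := by simp only [hq]; omega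
  -- The `n`-th coefficient of `c_x^{(n)}` in the frame is the derivative of the constant
  -- determinant: differentiating any other column repeats a column.
  have h0 : curvature c n x = 0 := by
    have h1 := hasDerivAt_det (A := frame c) (A' := matDeriv (frame c) x) (x := x) fun a k =>
      ((matSmooth_frame hc).differentiableAt a k x).hasDerivAt
    simp only [hdet] at h1
    have h2 := h1.unique (hasDerivAt_const x 1)
    rw [← h2, Matrix.trace, Finset.sum_eq_single q]
    · have hq2 : curvature c n x = curvature c (q + 1) x :=
        congrArg (fun i => curvature c i x) hq1.symm
      rw [Matrix.diag_apply, Matrix.mul_apply, hq2, ← hcurv q, Matrix.mulVec, dotProduct]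
      refine Finset.sum_congr rfl fun l _ => ?_
      rw [matDeriv_frame_apply, hq1]
    · intro k _ hk
      have hk1 : (k : ℕ) + 1 < n := by
        have : ¬ (k : ℕ) = q := fun h => hk (Fin.ext h)
        have := k.2
        omega
      have h3 : ((frame c x).adjugate * frame c x) k ⟨k + 1, hk1⟩ = 0 := by
        rw [Matrix.adjugate_mul, Matrix.smul_apply, Matrix.one_apply_ne, smul_zero]
        intro h
        have := congrArg Fin.val h
        simp at this
      rw [Matrix.diag_apply, ← h3, Matrix.mul_apply, Matrix.mul_apply]
      refine Finset.sum_congr rfl fun l _ => ?_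
      rw [matDeriv_frame_apply]
      rfl
    · simp
  ext a k
  rw [matDeriv_frame_apply]
  by_cases hk : (k : ℕ) + 1 < n
  · rw [mul_conn_apply_of_lt _ _ _ _ _ hk]
    rfl
  · have hkn : (k : ℕ) + 1 = n := by have := k.2; omega
    rw [mul_conn_apply_last _ _ _ _ _ hkn, hkn]
    refine (hv2 a).trans (Finset.sum_congr rfl fun l _ => ?_)
    split_ifs with hl
    · rfl
    · rw [show (l : ℕ) + 1 = n by have := l.2; omega, h0]

section Curve

variable {n : ℕ} {γ : ℝ → ℝ → Fin n → ℝ}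

theorem smooth₂_component (hγ : ContDiff ℝ ∞ (fun p : ℝ × ℝ => γ p.1 p.2)) (a : Fin n) :
    Smooth₂ fun x t => γ x t a :=
  contDiff_pi.1 hγ a

theorem matSmooth₂_frame (hγ : ContDiff ℝ ∞ (fun p : ℝ × ℝ => γ p.1 p.2)) :
    MatSmooth₂ fun x t => frame (fun y => γ y t) x :=
  fun a k => (smooth₂_component hγ a).iteratedDeriv_fst k

theorem smooth₂_curvature (hγ : ContDiff ℝ ∞ (fun p : ℝ × ℝ => γ p.1 p.2)) (i : ℕ) :
    Smooth₂ fun x t => curvature (fun y => γ y t) i x :=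
  contDiff_det fun a _ => (smooth₂_component hγ a).iteratedDeriv_fst _

end Curve

theorem matSmooth₂_conn {n : ℕ} {u : ℝ → ℕ → ℝ → ℝ} (hu : ∀ i, Smooth₂ fun x t => u t i x) :
    MatSmooth₂ fun x t => conn n (u t) x := by
  intro a c
  simp only [conn, Matrix.add_apply, potential, Matrix.of_apply]
  split_ifs
  · exact contDiff_const.add (hu _)
  · exact contDiff_const

theorem smooth₂_newPotentialAux (n : ℕ) {u : ℝ → ℕ → ℝ → ℝ} (hu : ∀ i, Smooth₂ fun x t => u t i x)
    {h : ℝ → ℝ → ℝ} (hh : Smooth₂ h) (q : ℕ) :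
    Smooth₂ fun x t => newPotentialAux n (u t) (fun y => h y t) q x := by
  induction q with
  | zero => exact contDiff_const
  | succ q ih =>
    have hd : ∀ k, Smooth₂ fun x t => iteratedDeriv k (fun y => h y t) x := hh.iteratedDeriv_fst
    refine ContDiff.sub (ContDiff.sub (ContDiff.sub (ContDiff.add (hu _) ?_)
      (ContDiff.mul hh ih)) ?_) (contDiff_const.mul (hd _))
    · exact ContDiff.sum fun m _ => (contDiff_const.mul (hd _)).mul (hu m)
    · have h1 : Smooth₂ fun x t => newPotentialAux n (u t) (fun y => h y t) q x
          + ((n - 1).choose (n - q - 1) : ℝ) * iteratedDeriv q (fun y => h y t) x :=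
        ContDiff.add ih (contDiff_const.mul (hd q))
      exact h1.deriv_fst

theorem smooth₂_newPotential (n : ℕ) {u : ℝ → ℕ → ℝ → ℝ} (hu : ∀ i, Smooth₂ fun x t => u t i x)
    {h : ℝ → ℝ → ℝ} (hh : Smooth₂ h) (i : ℕ) :
    Smooth₂ fun x t => newPotential n (u t) (fun y => h y t) i x :=
  smooth₂_newPotentialAux n hu hh _

theorem matSmooth₂_darboux (n : ℕ) {u : ℝ → ℕ → ℝ → ℝ} (hu : ∀ i, Smooth₂ fun x t => u t i x)
    {h : ℝ → ℝ → ℝ} (hh : Smooth₂ h) :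
    MatSmooth₂ fun x t => darboux n (u t) (fun y => h y t) x 0 := by
  intro a c
  simp only [darboux, Nmat, Matrix.add_apply, Matrix.smul_apply, Matrix.of_apply, smul_eq_mul]
  refine ContDiff.add (contDiff_const.add (ContDiff.mul hh contDiff_const)) ?_
  split_ifs
  · exact ContDiff.add (smooth₂_newPotential n hu hh _)
      (contDiff_const.mul (hh.iteratedDeriv_fst _))
  · exact ContDiff.add contDiff_const (contDiff_const.mul (hh.iteratedDeriv_fst _))
  · exact contDiff_const

theorem mulVec_e₁ {n : ℕ} (hn : 0 < n) (M : Matrix (Fin n) (Fin n) ℝ) (a : Fin n) :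
    M.mulVec (e₁ n) a = M a ⟨0, hn⟩ := by
  rw [Matrix.mulVec, dotProduct, Finset.sum_eq_single ⟨0, hn⟩]
  · simp [e₁]
  · intro l _ hl
    have : ¬ (l : ℕ) = 0 := fun h => hl (Fin.ext h)
    simp [e₁, this]
  · simp

namespace IsCurveFlowSolution

variable {n j : ℕ} {γ : ℝ → ℝ → Fin n → ℝ} (hγ : IsCurveFlowSolution n j γ)
include hγ

theorem contDiff_curvature (t : ℝ) (i : ℕ) : ContDiff ℝ ∞ (curvature (fun y => γ y t) i) :=
  (smooth₂_curvature hγ.smooth i).fst t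

theorem matDeriv_fst (hn : 1 ≤ n) (x t : ℝ) : matDeriv (frame fun y => γ y t) x
    = frame (fun y => γ y t) x * conn n (curvature fun y => γ y t) x :=
  matDeriv_frame hn (fun a => (smooth₂_component hγ.smooth a).fst t) (fun x => hγ.det_eq_one x t) x

/-- `g_t = g Z_{j,0}(u)`. -/
theorem matDeriv_snd (hn : 2 ≤ n) (x t : ℝ) : matDeriv (fun s => frame (fun y => γ y s) x) t
    = frame (fun y => γ y t) x * Zj0 n j (curvature fun y => γ y t) x := by
  have hu := hγ.contDiff_curvature t
  have hZ := matSmooth_Zj0 hn hu j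
  have hg := matSmooth₂_frame hγ.smooth
  -- Induction on columns. The flow gives column `0`, and column `k + 1` of the frame is the
  -- `x`-derivative of column `k`, so mixed partials are exchanged. The position `x` stays general
  -- because the induction hypothesis is differentiated in it.
  suffices H : ∀ (k : ℕ) (x : ℝ) (a c : Fin n), (c : ℕ) = k →
      matDeriv (fun s => frame (fun y => γ y s) x) t a c
        = (frame (fun y => γ y t) x * Zj0 n j (curvature fun y => γ y t) x) a c by
    ext a c
    exact H c x a c rfl
  intro k
  induction k with
  | zero =>
    intro x a c hc
    have h1 := (hasDerivAt_pi.1 (hγ.flow x t) a).deriv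
    rw [mulVec_e₁ (by omega)] at h1
    rw [show c = ⟨0, by omega⟩ from Fin.ext hc, ← h1]
    simp [matDeriv, frame]
  | succ k ih =>
    intro x a c hc
    have hk : k + 1 < n := by have := c.2; omega
    set c' : Fin n := ⟨k, by omega⟩ with hc'
    have hcc : c = ⟨(c' : ℕ) + 1, hk⟩ := Fin.ext hc
    have h1 : matDeriv (fun s => frame (fun y => γ y s) x) t a c
        = matDeriv (fun s => matDeriv (frame fun y => γ y s) x) t a c' := by
      simp only [matDeriv, Matrix.of_apply]
      congr 1
      funext s
      have := matDeriv_frame_apply (fun y => γ y s) x a c'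
      simp only [matDeriv, Matrix.of_apply] at this
      rw [this, frame_apply, hc]
    have h2 : matDeriv (fun y => matDeriv (fun s => frame (fun y => γ y s) y) t) x a c'
        = matDeriv (fun y => frame (fun y => γ y t) y * Zj0 n j (curvature fun y => γ y t) y) x
          a c' := by
      simp only [matDeriv, Matrix.of_apply]
      congr 1
      funext y
      exact ih y a c' rfl
    have h3 : matDeriv (Zj0 n j (curvature fun y => γ y t)) x
        = bracket n (curvature fun y => γ y t) (Zj0 n j (curvature fun y => γ y t)) x
          - conn n (curvature fun y => γ y t) x * Zj0 n j (curvature fun y => γ y t) x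
          + Zj0 n j (curvature fun y => γ y t) x * conn n (curvature fun y => γ y t) x := by
      simp only [bracket, conn]
      abel
    -- A `V_n`-valued bracket has only its last column non-zero, so it does not disturb the earlier
    -- columns.
    have h4 : (frame (fun y => γ y t) x
        * bracket n (curvature fun y => γ y t) (Zj0 n j (curvature fun y => γ y t)) x) a c' = 0 := by
      rw [Matrix.mul_apply]
      refine Finset.sum_eq_zero fun l _ => ?_
      rw [inVn_bracket_Zj0 hn hu j x l c' (by change ¬ (k + 1 = n ∧ _); omega), mul_zero]
    rw [h1, hg.matDeriv_comm, h2, matDeriv_mul (hg.fst t) hZ, hγ.matDeriv_fst (by omega) x t, h3,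
      hcc, ← mul_conn_apply_of_lt (curvature fun y => γ y t) x (_ * _) a c' hk]
    rw [mul_add, mul_sub, mul_assoc, mul_assoc, Matrix.add_apply, Matrix.add_apply,
      Matrix.sub_apply, h4]
    ring

/-- The flow of the curvature: `u_t = [∂_x + b + u, Z_{j,0}(u)]`. -/
theorem matDeriv_conn (hn : 2 ≤ n) (x t : ℝ) :
    matDeriv (fun s => conn n (curvature fun y => γ y s) x) t
      = bracket n (curvature fun y => γ y t) (Zj0 n j (curvature fun y => γ y t)) x := by
  have hu := hγ.contDiff_curvature t
  have hZ := matSmooth_Zj0 hn hu j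
  have hg := matSmooth₂_frame hγ.smooth
  have hA := matSmooth₂_conn (n := n) (smooth₂_curvature hγ.smooth)
  have h1 := hg.matDeriv_comm x t
  have h2 : (fun s => matDeriv (fun y => frame (fun y => γ y s) y) x)
      = fun s => frame (fun y => γ y s) x * conn n (curvature fun y => γ y s) x :=
    funext fun s => hγ.matDeriv_fst (by omega) x s
  have h3 : (fun y => matDeriv (fun s => frame (fun y => γ y s) y) t)
      = fun y => frame (fun y => γ y t) y * Zj0 n j (curvature fun y => γ y t) y :=
    funext fun y => hγ.matDeriv_snd hn y t
  rw [h2, h3, matDeriv_mul (hg.snd x) (hA.snd x), matDeriv_mul (hg.fst t) hZ,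
    hγ.matDeriv_snd hn, hγ.matDeriv_fst (by omega)] at h1
  have hdet : IsUnit (frame (fun y => γ y t) x).det := by
    rw [hγ.det_eq_one]
    exact isUnit_one
  have h4 : frame (fun y => γ y t) x * matDeriv (fun s => conn n (curvature fun y => γ y s) x) t
      = frame (fun y => γ y t) x
        * bracket n (curvature fun y => γ y t) (Zj0 n j (curvature fun y => γ y t)) x := by
    rw [eq_sub_of_add_eq' h1]
    change _ = _ * (_ + conn n _ x * _ - _ * conn n _ x)
    noncomm_ring
  have h5 := congrArg (fun M => (frame (fun y => γ y t) x)⁻¹ * M) h4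
  simpa only [Matrix.nonsing_inv_mul_cancel_left _ _ hdet] using h5

end IsCurveFlowSolution

theorem mul_darboux_apply_of_inVn {n : ℕ} {W : Matrix (Fin n) (Fin n) ℝ} (hW : InVn n W)
    (u : ℕ → ℝ → ℝ) (h : ℝ → ℝ) (x : ℝ) (a c q : Fin n) (hq : (q : ℕ) + 1 = n) :
    (W * darboux n u h x 0) a c = W a q * darboux n u h x 0 q c := by
  rw [Matrix.mul_apply, Finset.sum_eq_single q]
  · intro l _ hl
    have hl' : ¬ (l : ℕ) = q := fun h => hl (Fin.ext h)
    rw [hW a l (by omega), zero_mul]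
  · simp

/-- Uniqueness for the linear system satisfied by `f_t - (f Z_{j,0}(u) - Z_{j,0}(ũ) f)`: its
solutions are determined by their first column. -/
theorem eq_zero_of_first_column {n : ℕ} (hn : 2 ≤ n) (u v : ℕ → ℝ → ℝ) (h : ℝ → ℝ)
    {P W : ℝ → Matrix (Fin n) (Fin n) ℝ} (hW : ∀ x, InVn n (W x))
    (hcol : ∀ (x : ℝ) (a c : Fin n), (c : ℕ) = 0 → P x a c = 0)
    (hP : ∀ x, matDeriv P x = P x * conn n u x - conn n v x * P x - W x * darboux n u h x 0)
    (x : ℝ) : P x = 0 := by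
  set q : Fin n := ⟨n - 1, by omega⟩ with hqdef
  have hq : (q : ℕ) + 1 = n := by simp only [hqdef]; omega
  have hentry : ∀ (x : ℝ) (a c : Fin n), deriv (fun y => P y a c) x = (P x * conn n u x) a c
      - (conn n v x * P x) a c - W x a q * darboux n u h x 0 q c := by
    intro x a c
    rw [← mul_darboux_apply_of_inVn (hW x) u h x a c q hq, ← Matrix.sub_apply, ← Matrix.sub_apply,
      ← hP x]
    rfl
  -- If column `c` of `P` vanishes identically, the equation for that column yields column `c + 1`
  -- algebraically. The factor from the last row of `f` is zero until the subdiagonal entry `1` is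
  -- reached in column `n - 2`.
  have hstep : ∀ (c : Fin n) (hc : (c : ℕ) + 1 < n), (∀ x a, P x a c = 0) →
      ∀ x a, P x a ⟨c + 1, hc⟩ = W x a q * darboux n u h x 0 q c := by
    intro c hc h0 x a
    have h1 := hentry x a c
    have h2 : (fun y => P y a c) = fun _ => 0 := funext fun y => h0 y a
    rw [h2, mul_conn_apply_of_lt u x _ a c hc, conn_mul_apply] at h1
    simp only [h0, deriv_const, mul_zero, ite_self, add_zero, sub_zero] at h1
    linarith
  have hlt : ∀ (c : ℕ) (hc : c + 1 < n) (x : ℝ) (a : Fin n), P x a ⟨c, by omega⟩ = 0 := by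
    intro c
    induction c with
    | zero => intro _ x a; exact hcol x a _ rfl
    | succ c ih =>
      intro hc x a
      rw [hstep ⟨c, by omega⟩ (by change c + 1 < n; omega) (fun x a => ih (by omega) x a) x a,
        darboux_zero_apply_of_gt _ _ _ _ _ (by change c + 1 < (q : ℕ); omega), mul_zero]
  have hPW : ∀ x a, P x a q = W x a q := by
    intro x a
    have h1 := hstep ⟨n - 2, by omega⟩ (by change n - 2 + 1 < n; omega)
      (fun x a => hlt (n - 2) (by omega) x a) x a
    rw [darboux_zero_apply_succ _ _ _ _ _ (by change (q : ℕ) = n - 2 + 1; omega), mul_one] at h1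
    rw [← h1]
    congr 1
    exact Fin.ext (by change (q : ℕ) = n - 2 + 1; omega)
  -- The last column of `P` now equals that of `W`, whose last entry is zero. The equation for row
  -- `a + 1` then gives the entry in row `a`, so zeros propagate upwards.
  have hrow : ∀ m : ℕ, ∀ a : Fin n, (a : ℕ) + 1 + m = n → ∀ x, P x a q = 0 := by
    intro m
    induction m with
    | zero =>
      intro a ha x
      rw [hPW, hW x a q (by omega)]
    | succ m ih =>
      intro a ha x
      set a' : Fin n := ⟨a + 1, by omega⟩ with ha'
      have h1 := hentry x a' q
      have h0 : (fun y => P y a' q) = fun _ => 0 :=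
        funext fun y => ih a' (by change (a : ℕ) + 1 + 1 + m = n; omega) y
      have hlast : P x q q = 0 := by rw [hPW, hW x q q (by omega)]
      have h2 : (P x * conn n u x) a' q = 0 := by
        rw [mul_conn_apply_last u x _ a' q hq]
        refine Finset.sum_eq_zero fun l _ => ?_
        split_ifs with hl
        · rw [hlt l hl x a', zero_mul]
        · rw [mul_zero]
      have h3 : (conn n v x * P x) a' q = P x a q := by
        have h4 : P x ⟨n - 1, by omega⟩ q = 0 := hlast
        rw [conn_mul_apply, if_neg (by change ¬ (a : ℕ) + 1 = 0; omega), h4]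
        simp [ha']
      have h4 : W x a' q = 0 := by
        rw [← hPW]
        exact congrFun h0 x
      rw [h0, h2, h3, h4, deriv_const] at h1
      linarith
  ext a c
  by_cases hc : (c : ℕ) + 1 < n
  · exact hlt c hc x a
  · have hcq : c = q := Fin.ext (by have := c.2; omega)
    rw [hcq]
    exact hrow (n - 1 - a) a (by omega) x

section Backlund

variable {n j : ℕ} {γ : ℝ → ℝ → Fin n → ℝ} {k : ℝ} {h : ℝ → ℝ → ℝ}

/-- The determinant of `f_{u,h}(x, 0)` along a solution of `(BT)_{u,k}`. -/
theorem IsBTSolution.det_darboux_zero {u : ℝ → ℕ → ℝ → ℝ} (hh : IsBTSolution n j u k h)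
    (hn : 1 ≤ n) (x t : ℝ) : (darboux n (u t) (fun y => h y t) x 0).det = (-1) ^ n * k := by
  rw [det_darboux hn, hh.eq_x]
  obtain ⟨m, rfl⟩ : ∃ m, n = m + 1 := ⟨n - 1, by omega⟩
  rw [Nat.add_sub_cancel, pow_succ]
  ring

/-- The evolution of `f = f_{u,h}`: `f_t = f Z_{j,0}(u) - Z_{j,0}(ũ) f`. -/
theorem matDeriv_darboux_snd (hn : 2 ≤ n) (hγ : IsCurveFlowSolution n j γ)
    (hh : IsBTSolution n j (fun t => curvature fun y => γ y t) k h) (x t : ℝ) :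
    matDeriv (fun s => darboux n (curvature fun y => γ y s) (fun y => h y s) x 0) t
      = darboux n (curvature fun y => γ y t) (fun y => h y t) x 0
          * Zj0 n j (curvature fun y => γ y t) x
        - Zj0 n j (newPotential n (curvature fun y => γ y t) fun y => h y t) x
          * darboux n (curvature fun y => γ y t) (fun y => h y t) x 0 := by
  have hu2 : ∀ i, Smooth₂ fun x t => curvature (fun y => γ y t) i x := smooth₂_curvature hγ.smooth
  have hv2 := smooth₂_newPotential n hu2 (u := fun t => curvature fun y => γ y t) hh.smooth
  have hf2 := matSmooth₂_darboux n hu2 (u := fun t => curvature fun y => γ y t) hh.smooth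
  have hA2 := matSmooth₂_conn (n := n) hu2
  have hB2 := matSmooth₂_conn (n := n) hv2
  have hu := fun t i => (hu2 i).fst t
  have hv := fun t i => (hv2 i).fst t
  have hht := fun t => Smooth₂.fst hh.smooth t
  have hfx := fun x t => matDeriv_darboux hn (hu t) (hht t)
    (hh.det_darboux_zero (by omega) · t) x
  have hZ := matSmooth_Zj0 hn (hu t) j
  have hZ' := matSmooth_Zj0 hn (hv t) j
  have hAt := fun x => hγ.matDeriv_conn hn x t
  set u := fun t => curvature fun y => γ y t with hudef
  set v := fun t => newPotential n (u t) fun y => h y t with hvdef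
  set f := fun x t => darboux n (u t) (fun y => h y t) x 0 with hfdef
  set Z := Zj0 n j (u t) with hZdef
  set Z' := Zj0 n j (v t) with hZ'def
  set D : ℝ → Matrix (Fin n) (Fin n) ℝ := fun x => f x t * Z x - Z' x * f x t with hD
  -- The failure of `ũ` to follow the `j`-th flow. It is not known to vanish at this point; only its
  -- membership in `V_n` is used.
  set W : ℝ → Matrix (Fin n) (Fin n) ℝ := fun x =>
    matDeriv (fun s => conn n (v s) x) t - bracket n (v t) Z' x with hWdef
  have hDs : MatSmooth D := ((hf2.fst t).mul hZ).sub (hZ'.mul (hf2.fst t))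
  have hW : ∀ x, InVn n (W x) := by
    intro x a c hac
    have h1 : matDeriv (fun s => conn n (v s) x) t a c = 0 := by
      simp only [matDeriv, conn, potential, Matrix.of_apply, Matrix.add_apply, if_neg hac,
        deriv_const]
    simp only [hWdef, Matrix.sub_apply]
    rw [h1, inVn_bracket_Zj0 hn (hv t) j x a c hac, sub_zero]
  have key := eq_zero_of_first_column hn (u t) (v t) (fun y => h y t)
    (P := fun x => matDeriv (fun s => f x s) t - D x) hW ?_ ?_ x
  · exact sub_eq_zero.1 key
  · intro x a c hc
    change deriv (fun s => f x s a c) t - D x a c = 0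
    by_cases ha : (a : ℕ) = 0
    · have hac : a = c := Fin.ext (by omega)
      subst hac
      have h1 : (fun s => f x s a a) = fun s => h x s :=
        funext fun s => darboux_zero_last (u s) (fun y => h y s) x a
      have h2 : eta n j (u t) (fun y => h y t) x = D x a a := by
        have h3 : eta n j (u t) (fun y => h y t) x = dotProduct (e₁ n) ((D x).mulVec (e₁ n)) := rfl
        rw [h3, dotProduct, Finset.sum_eq_single a]
        · rw [mulVec_e₁ (by omega), show (⟨0, by omega⟩ : Fin n) = a from Fin.ext ha.symm]
          simp [e₁, ha]
        · intro l _ hl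
          have : ¬ (l : ℕ) = 0 := fun h => hl (Fin.ext (by omega))
          simp [e₁, this]
        · simp
      rw [h1, (hh.eq_t x t).deriv, h2, sub_self]
    · have h1 : (fun s => f x s a c) = fun _ => f x t a c := by
        funext s
        simp only [hfdef]
        rcases Nat.lt_or_eq_of_le (show (c : ℕ) + 1 ≤ a by omega) with h2 | h2
        · rw [darboux_zero_apply_of_gt _ _ _ _ _ h2, darboux_zero_apply_of_gt _ _ _ _ _ h2]
        · rw [darboux_zero_apply_succ _ _ _ _ _ h2.symm, darboux_zero_apply_succ _ _ _ _ _ h2.symm]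
      have h2 : D x a c = 0 := gauge_Zj0_apply hn (hu t) (hv t) (hf2.fst t)
        (fun x a c hac => darboux_zero_apply_of_gt _ _ _ _ _ hac)
        (fun x => e1n_darboux hn _ _ _ x) (fun x => hfx x t) j x a c ha hc
      rw [h1, h2, deriv_const, sub_zero]
  · intro x
    have h1 := hf2.matDeriv_comm x t
    have h2 : (fun s => matDeriv (fun y => f y s) x)
        = fun s => f x s * conn n (u s) x - conn n (v s) x * f x s := funext fun s => hfx x s
    rw [h2, matDeriv_sub ((hf2.mul hA2).snd x) ((hB2.mul hf2).snd x),
      matDeriv_mul (hf2.snd x) (hA2.snd x), matDeriv_mul (hB2.snd x) (hf2.snd x), hAt x] at h1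
    have h6 : matDeriv (fun s => f x s) t * conn n (u t) x + f x t * bracket n (u t) Z x
        - (matDeriv (fun s => conn n (v s) x) t * f x t
          + conn n (v t) x * matDeriv (fun s => f x s) t)
        = matDeriv (fun y => matDeriv (fun s => f y s) t) x := h1
    have h7 : matDeriv (fun y => f y t) x = f x t * conn n (u t) x - conn n (v t) x * f x t :=
      hfx x t
    rw [matDeriv_sub (hf2.deriv_snd.fst t) hDs, ← h6,
      matDeriv_sub ((hf2.fst t).mul hZ) (hZ'.mul (hf2.fst t)), matDeriv_mul (hf2.fst t) hZ,
      matDeriv_mul hZ' (hf2.fst t), h7]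
    have h3 : bracket n (u t) Z x = matDeriv Z x + conn n (u t) x * Z x - Z x * conn n (u t) x :=
      rfl
    have h4 : bracket n (v t) Z' x
        = matDeriv Z' x + conn n (v t) x * Z' x - Z' x * conn n (v t) x := rfl
    have h5 : darboux n (u t) (fun y => h y t) x 0 = f x t := rfl
    simp only [hWdef, hD, h3, h4, h5]
    noncomm_ring

theorem btFrame_mul_darboux (hn : 1 ≤ n) (hk : k ≠ 0) (d : Matrix (Fin n) (Fin n) ℝ)
    (hh : IsBTSolution n j (fun t => curvature fun y => γ y t) k h) (x t : ℝ) :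
    btFrame d γ h x t * darboux n (curvature fun y => γ y t) (fun y => h y t) x 0
      = d * frame (fun y => γ y t) x := by
  refine Matrix.nonsing_inv_mul_cancel_right _ _ ?_
  have := hh.det_darboux_zero hn x t
  rw [this]
  exact isUnit_iff_ne_zero.2 (mul_ne_zero (pow_ne_zero _ (by norm_num)) hk)

theorem matSmooth₂_btFrame (hn : 1 ≤ n) (d : Matrix (Fin n) (Fin n) ℝ)
    (hγ : ContDiff ℝ ∞ (fun p : ℝ × ℝ => γ p.1 p.2))
    (hh : IsBTSolution n j (fun t => curvature fun y => γ y t) k h) :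
    MatSmooth₂ (btFrame d γ h) := by
  have hf2 := matSmooth₂_darboux n (smooth₂_curvature hγ) (u := fun t => curvature fun y => γ y t)
    hh.smooth
  have hd2 : MatSmooth₂ fun _ _ : ℝ => d := fun a c => contDiff_const
  refine (hd2.mul (matSmooth₂_frame hγ)).mul fun a c => ?_
  -- Since the determinant is constant, the inverse is a constant multiple of the adjugate and hence
  -- smooth.
  have h1 : ∀ x t, (darboux n (curvature fun y => γ y t) (fun y => h y t) x 0)⁻¹ a c
      = ((-1) ^ n * k)⁻¹
        * (darboux n (curvature fun y => γ y t) (fun y => h y t) x 0).adjugate a c := by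
    intro x t
    have := hh.det_darboux_zero hn x t
    rw [Matrix.inv_def, this, Ring.inverse_eq_inv', Matrix.smul_apply, smul_eq_mul]
  simp only [h1]
  exact contDiff_const.mul (contDiff_adjugate hf2 a c)

theorem btFrame_det (hn : 1 ≤ n) (hk : k ≠ 0) {d : Matrix (Fin n) (Fin n) ℝ}
    (hd : d.det = (-1) ^ n * k) (hγ : IsCurveFlowSolution n j γ)
    (hh : IsBTSolution n j (fun t => curvature fun y => γ y t) k h) (x t : ℝ) :
    (btFrame d γ h x t).det = 1 := by
  have h1 := congrArg Matrix.det (btFrame_mul_darboux hn hk d hh x t)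
  have h2 := hh.det_darboux_zero hn x t
  rw [Matrix.det_mul, Matrix.det_mul, h2, hd, hγ.det_eq_one, mul_one] at h1
  exact (mul_eq_right₀ (mul_ne_zero (pow_ne_zero _ (by norm_num)) hk)).1 h1

theorem mul_darboux_cancel (hn : 1 ≤ n) (hk : k ≠ 0)
    (hh : IsBTSolution n j (fun t => curvature fun y => γ y t) k h) {x t : ℝ}
    {A B : Matrix (Fin n) (Fin n) ℝ}
    (hAB : A * darboux n (curvature fun y => γ y t) (fun y => h y t) x 0
      = B * darboux n (curvature fun y => γ y t) (fun y => h y t) x 0) : A = B := by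
  have h0 := hh.det_darboux_zero hn x t
  have h1 : IsUnit (darboux n (curvature fun y => γ y t) (fun y => h y t) x 0).det := by
    rw [h0]
    exact isUnit_iff_ne_zero.2 (mul_ne_zero (pow_ne_zero _ (by norm_num)) hk)
  have h2 := congrArg
    (fun M => M * (darboux n (curvature fun y => γ y t) (fun y => h y t) x 0)⁻¹) hAB
  simpa only [Matrix.mul_nonsing_inv_cancel_right _ _ h1] using h2

theorem matDeriv_const_mul {A : ℝ → Matrix (Fin n) (Fin n) ℝ} (hA : MatSmooth A)
    (d : Matrix (Fin n) (Fin n) ℝ) (x : ℝ) :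
    matDeriv (fun y => d * A y) x = d * matDeriv A x := by
  rw [matDeriv_mul (matSmooth_const d) hA, matDeriv_const]
  simp

/-- `g̃_x = g̃ (b + ũ)`. -/
theorem matDeriv_btFrame_fst (hn : 2 ≤ n) (hk : k ≠ 0) (d : Matrix (Fin n) (Fin n) ℝ)
    (hγ : IsCurveFlowSolution n j γ)
    (hh : IsBTSolution n j (fun t => curvature fun y => γ y t) k h) (x t : ℝ) :
    matDeriv (fun y => btFrame d γ h y t) x = btFrame d γ h x t
      * conn n (newPotential n (curvature fun y => γ y t) fun y => h y t) x := by
  have hu := hγ.contDiff_curvature t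
  have hht := Smooth₂.fst hh.smooth t
  have hf := matSmooth_darboux (n := n) hu hht
  have h1 := matDeriv_mul ((matSmooth₂_btFrame (by omega) d hγ.smooth hh).fst t) hf x
  have h2 := fun x => btFrame_mul_darboux (by omega) hk d hh x t
  simp only [h2] at h1
  rw [matDeriv_const_mul (A := frame fun y => γ y t)
    ((matSmooth₂_frame hγ.smooth).fst t),
    hγ.matDeriv_fst (by omega), ← mul_assoc, ← h2 x,
    matDeriv_darboux hn hu hht (hh.det_darboux_zero (by omega) · t)] at h1
  refine mul_darboux_cancel (by omega) hk hh (x := x) (t := t) ?_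
  rw [← sub_eq_iff_eq_add] at h1
  rw [← h1]
  noncomm_ring

/-- `g̃_t = g̃ Z_{j,0}(ũ)`. -/
theorem matDeriv_btFrame_snd (hn : 2 ≤ n) (hk : k ≠ 0) (d : Matrix (Fin n) (Fin n) ℝ)
    (hγ : IsCurveFlowSolution n j γ)
    (hh : IsBTSolution n j (fun t => curvature fun y => γ y t) k h) (x t : ℝ) :
    matDeriv (fun s => btFrame d γ h x s) t = btFrame d γ h x t
      * Zj0 n j (newPotential n (curvature fun y => γ y t) fun y => h y t) x := by
  have hf2 := matSmooth₂_darboux n (smooth₂_curvature hγ.smooth)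
    (u := fun t => curvature fun y => γ y t) hh.smooth
  have h1 := matDeriv_mul ((matSmooth₂_btFrame (by omega) d hγ.smooth hh).snd x) (hf2.snd x) t
  have h2 := fun t => btFrame_mul_darboux (by omega) hk d hh x t
  simp only [h2] at h1
  rw [matDeriv_const_mul (A := fun s => frame (fun y => γ y s) x)
    ((matSmooth₂_frame hγ.smooth).snd x),
    hγ.matDeriv_snd hn, ← mul_assoc, ← h2 t, matDeriv_darboux_snd hn hγ hh] at h1
  refine mul_darboux_cancel (by omega) hk hh (x := x) (t := t) ?_
  rw [← sub_eq_iff_eq_add] at h1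
  rw [← h1]
  noncomm_ring

theorem btCurve_apply (hn : 0 < n) (d : Matrix (Fin n) (Fin n) ℝ) (x t : ℝ) (a : Fin n) :
    btCurve d γ h x t a = btFrame d γ h x t a ⟨0, hn⟩ :=
  mulVec_e₁ hn _ a

/-- `g̃` is the central affine moving frame along `h ∗ γ`. -/
theorem frame_btCurve (hn : 2 ≤ n) (hk : k ≠ 0) (d : Matrix (Fin n) (Fin n) ℝ)
    (hγ : IsCurveFlowSolution n j γ)
    (hh : IsBTSolution n j (fun t => curvature fun y => γ y t) k h) (x t : ℝ) :
    frame (fun y => btCurve d γ h y t) x = btFrame d γ h x t := by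
  have H : ∀ (c : ℕ) (hc : c < n) (a : Fin n), iteratedDeriv c (fun y => btCurve d γ h y t a)
      = fun x => btFrame d γ h x t a ⟨c, hc⟩ := by
    intro c
    induction c with
    | zero =>
      intro hc a
      funext x
      rw [iteratedDeriv_zero]
      exact btCurve_apply hc d x t a
    | succ c ih =>
      intro hc a
      funext x
      rw [iteratedDeriv_succ, ih (by omega) a]
      have h1 := congrFun (congrFun (matDeriv_btFrame_fst hn hk d hγ hh x t) a) ⟨c, by omega⟩
      rw [mul_conn_apply_of_lt _ _ _ _ _ hc] at h1
      exact h1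
  ext a c
  exact congrFun (H c c.2 a) x

/-- `ũ` is the central affine curvature of `h ∗ γ`. -/
theorem curvature_btCurve (hn : 2 ≤ n) (hk : k ≠ 0) {d : Matrix (Fin n) (Fin n) ℝ}
    (hd : d.det = (-1) ^ n * k) (hγ : IsCurveFlowSolution n j γ)
    (hh : IsBTSolution n j (fun t => curvature fun y => γ y t) k h) (t : ℝ) (i : ℕ) (hi1 : 1 ≤ i)
    (hin : i < n) : curvature (fun y => btCurve d γ h y t) i
      = newPotential n (curvature fun y => γ y t) (fun y => h y t) i := by
  have hg : MatSmooth₂ (btFrame d γ h) := matSmooth₂_btFrame (by omega) d hγ.smooth hh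
  have hframe := frame_btCurve hn hk d hγ hh
  have hdet := btFrame_det (by omega) hk hd hγ hh
  have hsmooth : ∀ a, ContDiff ℝ ∞ fun y => btCurve d γ h y t a := by
    intro a
    simp only [btCurve_apply (show 0 < n by omega)]
    exact (hg.fst t) a _
  funext x
  have h1 := matDeriv_frame (by omega) hsmooth (fun x => by rw [hframe, hdet]) x
  have h2 : frame (fun y => btCurve d γ h y t) = fun y => btFrame d γ h y t :=
    funext fun y => hframe y t
  rw [h2, matDeriv_btFrame_fst hn hk d hγ hh] at h1
  have hu : IsUnit (btFrame d γ h x t).det := by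
    rw [hdet]
    exact isUnit_one
  have h3 := congrArg (fun M => (btFrame d γ h x t)⁻¹ * M) h1
  simp only [Matrix.nonsing_inv_mul_cancel_left _ _ hu] at h3
  have h4 := congrFun (congrFun h3 ⟨i - 1, by omega⟩) ⟨n - 1, by omega⟩
  rw [conn_apply_last _ _ _ _ (by change n - 1 + 1 = n; omega),
    conn_apply_last _ _ _ _ (by change n - 1 + 1 = n; omega)] at h4
  simp only [show i - 1 + 1 = i by omega, if_pos hin] at h4
  exact h4.symm

theorem isCurveFlowSolution_btCurve (hn : 2 ≤ n) (hk : k ≠ 0) {d : Matrix (Fin n) (Fin n) ℝ}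
    (hd : d.det = (-1) ^ n * k) (hγ : IsCurveFlowSolution n j γ)
    (hh : IsBTSolution n j (fun t => curvature fun y => γ y t) k h) :
    IsCurveFlowSolution n j (btCurve d γ h) where
  smooth := by
    refine contDiff_pi.2 fun a => ?_
    simp only [btCurve_apply (show 0 < n by omega)]
    exact matSmooth₂_btFrame (by omega) d hγ.smooth hh a _
  det_eq_one x t := by
    rw [frame_btCurve hn hk d hγ hh, btFrame_det (by omega) hk hd hγ hh]
  flow x t := by
    refine hasDerivAt_pi.2 fun a => ?_
    have hg := (matSmooth₂_btFrame (by omega) d hγ.smooth hh).snd x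
    simp only [btCurve_apply (show 0 < n by omega)]
    -- The curvature of the new curve is known to agree with `ũ` only in the components `1, …, n -
    -- 1`, which suffices for `Z_{j,0}`.
    rw [mulVec_e₁ (by omega), Zj0_congr j (curvature_btCurve hn hk hd hγ hh t),
      frame_btCurve hn hk d hγ hh, ← matDeriv_btFrame_snd hn hk d hγ hh]
    exact (hg.differentiableAt a _ t).hasDerivAt

end Backlund

end CentralAffine
end

theorem mainTheorem4 (n j : ℕ) (hn : 2 ≤ n) (hj : ¬ n ∣ j)
    (γ : ℝ → ℝ → Fin n → ℝ) (hγ : CentralAffine.IsCurveFlowSolution n j γ)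
    (k : ℝ) (hk : k ≠ 0)
    (d : Matrix (Fin n) (Fin n) ℝ) (hd : d.det = (-1) ^ n * k)
    (h : ℝ → ℝ → ℝ)
    (hh : CentralAffine.IsBTSolution n j
      (fun t => CentralAffine.curvature fun y => γ y t) k h) :
    CentralAffine.IsCurveFlowSolution n j (CentralAffine.btCurve d γ h) ∧
      ∀ x t : ℝ, CentralAffine.frame (fun y => CentralAffine.btCurve d γ h y t) x
        = CentralAffine.btFrame d γ h x t :=
  ⟨CentralAffine.isCurveFlowSolution_btCurve hn hk hd hγ hh,
    CentralAffine.frame_btCurve hn hk d hγ hh⟩
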